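/- Let $T\in M(n;\mathbb C)$ be a singular matrix whose imaginary part is positive definite ($x^t(\mathrm{Im}\,T)x>0$ for all real $x\neq 0$), let $\delta\in M(n;\mathbb Z)$ with $\det(T-\delta)\neq 0$, and put $T'=(-T+\delta)^{-1}$. For $\tau=T,T'$ let $T^{2n}_{J=\tau}=\mathbb C^n/2\pi(\mathbb Z^n\oplus\tau\mathbb Z^n)$, and let $\varphi:T^{2n}_{J=T}\to T^{2n}_{J=T'}$ be the biholomorphic map $\varphi(z)=(-T+\delta)^{-1}z$. Let $r$ be a positive integer, $\zeta=e^{2\pi\mathbf i/r}$, $\mu\in\mathbb C^n$, and let $A=(a_{ij})\in M(n;\mathbb Z)$ satisfy $AT'=(AT')^t$. Let $\tilde a_1\mid\tilde a_2\mid\cdots\mid\tilde a_n$ ($\tilde a_i\ge 0$) be the diagonal entries of the Smith normal form of $A$, and let $r'=\prod_i r/\gcd(r,\tilde a_i)$. (a) Let $\mathcal U$ be a family of unitary matrices $V_j,U_k\in U(r')$ $(1\le j,k\le n)$ with $V_jV_k=V_kV_j$, $U_jU_k=U_kU_j$, $\zeta^{-a_{kj}}U_kV_j=V_jU_k$. Let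 $E_{(r,A,\mu,\mathcal U)}\to T^{2n}_{J=T'}$ be the complex vector bundle of rank $r'$ whose sections, in the real coordinates $Z=X+T'Y$, satisfy $$s(X+2\pi e_j,Y)=e^{\frac{\mathbf i}{r}\sum_i a_{ij}Y_i}V_j\,s(X,Y),\qquad s(X,Y+2\pi e_k)=U_k\,s(X,Y),$$ with the connection $\nabla=d-\frac{\mathbf i}{2\pi}\bigl(\frac1rX^tA^t+\frac1r\mu^t\bigr)dY\cdot I_{r'}$. (b) Let $L=2\pi(\mathbb Z^n\oplus T\mathbb Z^n)$, with generators $\gamma_j=2\pi e_j$, $\gamma'_k=2\pi Te_k$, let $R=\frac{\mathbf i}{2\pi}\frac{r'}{r}\{(T-\bar T)^{-1}\}^tA^t$ and $\mathcal R(z,w)=\sum_{i,j}R_{ij}z_i\bar w_j$. Given unitary matrices $U(\gamma_j),U(\gamma'_k)\in U(r')$ with $$U(\gamma_j)U(\gamma_k)=U(\gamma_k)U(\gamma_j),\quad U(\gamma'_j)U(\gamma'_k)=\zeta^{(A^t\delta)_{jk}-(A^t\delta)_{kj}}U(\gamma'_k)U(\gamma'_j),\quad \zeta^{-a_{jk}}U(\gamma'_k)U(\gamma_j)=U(\gamma_j)U(\gamma'_k),$$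 there is exactly one extension $U:L\to U(r')$ for which $$j(\gamma,z)=U(\gamma)\exp\Bigl\{\tfrac1{r'}\mathcal R(z,\gamma)+\tfrac1{2r'}\mathcal R(\gamma,\gamma)\Bigr\}$$ is a factor of automorphy, i.e. $j(\gamma+\gamma',z)=j(\gamma,z+\gamma')j(\gamma',z)$. Let $\mathcal E_{(r,A,\mu,\mathcal U)}\to T^{2n}_{J=T}$ be the holomorphic vector bundle of rank $r'$ defined by $j$, with the connection $$\tilde\nabla=d-\tfrac1{r'}dz^tR\bar z\cdot I_{r'}-\tfrac{\mathbf i}{2\pi r}\mu^t(\delta-\bar T)(T-\bar T)^{-1}dz\cdot I_{r'}+\tfrac{\mathbf i}{2\pi r}\bar\mu^t(\delta-\bar T)(T-\bar T)^{-1}dz\cdot I_{r'}.$$ Then there is a bijection between the families $\mathcal U$ in (a) and the families in (b) such that, for corresponding families, $\varphi^*E_{(r,A,\mu,\mathcal U)}$ is a holomorphic vector bundle, $\mathcal E_{(r,A,\mu,\mathcal U)}$ is projectively flat (its curvature is a scalar 2-form times $I_{r'}$), and $$\varphi^*E_{(r,A,\mu,\mathcal U)}\cong\mathcal E_{(r,A,\mu,\mathcal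 U)}.$$ An isomorphism $\Psi$, both of holomorphic vector bundles and of bundles with connection ($\tilde\nabla\Psi=\Psi\,\varphi^*\nabla$), is expressed locally as $$\Psi(z,\bar z)=\exp\Bigl\{\tfrac{\mathbf i}{4\pi r'}z^t\bar{\mathcal A}z+\tfrac{\mathbf i}{4\pi r'}\bar z^t\mathcal A\bar z-\tfrac{\mathbf i}{2\pi r'}z^t\mathcal A\bar z+\tfrac{\mathbf i}{2\pi r}\bar z^t\{(T-\bar T)^{-1}\}^t(\delta-T)^t\mu-\tfrac{\mathbf i}{2\pi r}z^t\{(T-\bar T)^{-1}\}^t(\delta-\bar T)^t\bar\mu\Bigr\}\cdot I_{r'},$$ where $\mathcal A=\frac{r'}{r}\{(T-\bar T)^{-1}\}^tA^t(\delta-T)(T-\bar T)^{-1}$. -/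

import Mathlib

open Matrix Complex
open scoped ContDiff ComplexConjugate

/-! ### Complex tori -/

/-- The group of periods `ℤⁿ ⊕ ℤⁿ`; `(a, b)` stands for the lattice vector `2π(a + τ b)`. -/
abbrev Period (n : ℕ) : Type := (Fin n → ℤ) × (Fin n → ℤ)

/-- The lattice vector `2π(a + τ b)`. -/
noncomputable def period {n : ℕ} (τ : Matrix (Fin n) (Fin n) ℂ) : Period n →+ (Fin n → ℂ) where
  toFun γ := (2 * (Real.pi : ℂ)) • ((fun i => (γ.1 i : ℂ)) + τ *ᵥ (fun i => (γ.2 i : ℂ)))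
  map_zero' := by ext i; simp [Matrix.mulVec, dotProduct]
  map_add' γ γ' := by
    ext i
    simp [Matrix.mulVec, dotProduct, mul_add, Finset.sum_add_distrib]
    ring

/-- The complex torus `ℂⁿ / 2π(ℤⁿ ⊕ τ ℤⁿ)`. -/
abbrev Torus {n : ℕ} (τ : Matrix (Fin n) (Fin n) ℂ) : Type :=
  (Fin n → ℂ) ⧸ (period τ).range

/-- A biholomorphic isomorphism of complex tori: a `ℂ`-linear automorphism `lin` of `ℂⁿ` that
carries the lattice onto the lattice, through the isomorphism `per` of the period groups. -/
structure TorusIso {n : ℕ} (τ τ' : Matrix (Fin n) (Fin n) ℂ) where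
  lin : (Fin n → ℂ) ≃ₗ[ℂ] (Fin n → ℂ)
  per : Period n ≃+ Period n
  lin_period : ∀ γ, lin (period τ γ) = period τ' (per γ)

/-- The induced map of the quotient tori. -/
noncomputable def TorusIso.toAddEquiv {n : ℕ} {τ τ' : Matrix (Fin n) (Fin n) ℂ}
    (f : TorusIso τ τ') : Torus τ ≃+ Torus τ' :=
  QuotientAddGroup.congr _ _ f.lin.toAddEquiv (by
    ext w
    constructor
    · rintro ⟨_, ⟨γ, rfl⟩, rfl⟩
      exact ⟨f.per γ, (f.lin_period γ).symm⟩
    · rintro ⟨γ, rfl⟩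
      refine ⟨_, ⟨f.per.symm γ, rfl⟩, ?_⟩
      have := f.lin_period (f.per.symm γ)
      simpa using this)

/-! ### Complex vector bundles with connection on a complex torus -/

/-- A smooth complex vector bundle of rank `N` with a connection on `ℂⁿ / 2π(ℤⁿ ⊕ τ ℤⁿ)`, given on
the universal covering `ℂⁿ`: sections are the maps `s : ℂⁿ → ℂᴺ` with
`s (z + γ) = factor γ z • s z`, and the connection is `∇ = d + conn`. The last field says
that `∇ s` obeys the same transformation rule as `s`. -/
structure TorusBundle {n : ℕ} (τ : Matrix (Fin n) (Fin n) ℂ) (N : ℕ) where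
  factor : Period n → (Fin n → ℂ) → Matrix (Fin N) (Fin N) ℂ
  conn : (Fin n → ℂ) → (Fin n → ℂ) →ₗ[ℝ] Matrix (Fin N) (Fin N) ℂ
  factor_zero : ∀ z, factor 0 z = 1
  factor_add : ∀ γ γ' z, factor (γ + γ') z = factor γ (z + period τ γ') * factor γ' z
  factor_smooth : ∀ γ i j, ContDiff ℝ ∞ (fun z => factor γ z i j)
  conn_smooth : ∀ v i j, ContDiff ℝ ∞ (fun z => conn z v i j)
  conn_factor : ∀ γ z v i j,
    fderiv ℝ (fun w => factor γ w i j) z v + (conn (z + period τ γ) v * factor γ z) i j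
      = (factor γ z * conn z v) i j

namespace TorusBundle

variable {n N : ℕ} {τ τ' : Matrix (Fin n) (Fin n) ℂ}

/-- Two points of `ℂⁿ × ℂᴺ` are identified when a period carries one to the other. -/
def setoid (B : TorusBundle τ N) : Setoid ((Fin n → ℂ) × (Fin N → ℂ)) where
  r p q := ∃ γ, q = (p.1 + period τ γ, B.factor γ p.1 *ᵥ p.2)
  iseqv := {
    refl := fun p => ⟨0, by simp [B.factor_zero]⟩
    symm := by
      rintro p q ⟨γ, rfl⟩
      refine ⟨-γ, ?_⟩
      have h := B.factor_add (-γ) γ p.1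
      rw [neg_add_cancel, B.factor_zero] at h
      simp [Matrix.mulVec_mulVec, ← h]
    trans := by
      rintro p q s ⟨γ, rfl⟩ ⟨γ', rfl⟩
      refine ⟨γ' + γ, ?_⟩
      simp [B.factor_add, Matrix.mulVec_mulVec, add_assoc, add_comm (period τ γ)] }

/-- The total space `(ℂⁿ × ℂᴺ) / (ℤⁿ ⊕ ℤⁿ)` with the quotient topology. -/
def TotalSpace (B : TorusBundle τ N) : Type := Quotient B.setoid

instance (B : TorusBundle τ N) : TopologicalSpace B.TotalSpace :=
  inferInstanceAs (TopologicalSpace (Quotient B.setoid))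

/-- The class of `(z, v)`. -/
def pt (B : TorusBundle τ N) (z : Fin n → ℂ) (v : Fin N → ℂ) : B.TotalSpace :=
  Quotient.mk B.setoid (z, v)

/-- The projection to the torus. -/
noncomputable def proj (B : TorusBundle τ N) : B.TotalSpace → Torus τ :=
  Quotient.lift (fun p => (QuotientAddGroup.mk p.1 : Torus τ)) (by
    rintro p q ⟨γ, rfl⟩
    exact QuotientAddGroup.eq.2 ⟨γ, by simp⟩)

/-- The covariant derivative `∇_v s = ds(v) + conn(v) s` of a local section. -/
noncomputable def covDeriv (B : TorusBundle τ N) (s : (Fin n → ℂ) → (Fin N → ℂ))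
    (z v : Fin n → ℂ) : Fin N → ℂ :=
  fderiv ℝ s z v + B.conn z v *ᵥ s z

/-- Twice the `(0,1)`-part of the covariant derivative: `∇_v s + i ∇_{iv} s`. -/
noncomputable def dbar (B : TorusBundle τ N) (s : (Fin n → ℂ) → (Fin N → ℂ))
    (z v : Fin n → ℂ) : Fin N → ℂ :=
  B.covDeriv s z v + I • B.covDeriv s z (I • v)

/-- The curvature form `dω + ω ∧ ω`, `ω` the connection form, on two tangent vectors. -/
noncomputable def curvature (B : TorusBundle τ N) (z u v : Fin n → ℂ) :
    Matrix (Fin N) (Fin N) ℂ :=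
  Matrix.of (fun i j => fderiv ℝ (fun w => B.conn w v i j) z u
      - fderiv ℝ (fun w => B.conn w u i j) z v)
    + (B.conn z u * B.conn z v - B.conn z v * B.conn z u)

/-- The connection is projectively flat: its curvature is a scalar 2-form times the identity. -/
def IsProjectivelyFlat (B : TorusBundle τ N) : Prop :=
  ∃ α : (Fin n → ℂ) → (Fin n → ℂ) → (Fin n → ℂ) → ℂ, ∀ z u v, B.curvature z u v = α z u v • 1

/-- The `(0,2)`-part of the curvature vanishes: the `(0,1)`-part of the connection is
the `∂̄`-operator of a holomorphic vector bundle. -/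
def IsHolomorphic (B : TorusBundle τ N) : Prop :=
  ∀ z u v, B.curvature z u v + I • B.curvature z (I • u) v + I • B.curvature z u (I • v)
    - B.curvature z (I • u) (I • v) = 0

/-- The pullback `f^*B` of a bundle with connection along an isomorphism of tori. -/
noncomputable def pullback (f : TorusIso τ τ') (B : TorusBundle τ' N) : TorusBundle τ N where
  factor γ z := B.factor (f.per γ) (f.lin z)
  conn z := (B.conn (f.lin z)).comp (f.lin.toLinearMap.restrictScalars ℝ)
  factor_zero z := by simp [B.factor_zero]
  factor_add γ γ' z := by simp [B.factor_add, f.lin_period]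
  factor_smooth γ i j := (B.factor_smooth (f.per γ) i j).comp
    (f.lin.toLinearMap.restrictScalars ℝ).toContinuousLinearMap.contDiff
  conn_smooth v i j := (B.conn_smooth (f.lin v) i j).comp
    (f.lin.toLinearMap.restrictScalars ℝ).toContinuousLinearMap.contDiff
  conn_factor γ z v i j := by
    have h := B.conn_factor (f.per γ) (f.lin z) (f.lin v) i j
    set L := (f.lin.toLinearMap.restrictScalars ℝ).toContinuousLinearMap with hL
    have hd : fderiv ℝ (fun w => B.factor (f.per γ) (f.lin w) i j) z v
        = fderiv ℝ (fun w => B.factor (f.per γ) w i j) (f.lin z) (f.lin v) := by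
      have h1 : DifferentiableAt ℝ (fun w => B.factor (f.per γ) w i j) (L z) :=
        ((B.factor_smooth (f.per γ) i j).differentiable (by simp)).differentiableAt
      have h2 := h1.hasFDerivAt.comp z L.hasFDerivAt
      have h3 := h2.fderiv
      exact congrArg (fun l => l v) h3
    rw [hd]
    simpa [f.lin_period] using h

/-- The canonical map `f^*B → B`. -/
noncomputable def pullbackMap (f : TorusIso τ τ') (B : TorusBundle τ' N) :
    (pullback f B).TotalSpace → B.TotalSpace :=
  Quotient.lift (fun p => B.pt (f.lin p.1) p.2) (by
    rintro p q ⟨γ, rfl⟩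
    exact Quotient.sound ⟨f.per γ, by simp [f.lin_period, pullback]⟩)

/-- `f^*B` is the pullback of `B`: each of its points is determined by its images in the torus
and in the total space of `B`, and these are the pairs of points over the same point. -/
theorem pullback_isPullback (f : TorusIso τ τ') (B : TorusBundle τ' N)
    (hτ' : Function.Injective (period τ')) :
    (∀ p, B.proj (pullbackMap f B p) = f.toAddEquiv ((pullback f B).proj p)) ∧
    ∀ (x : Torus τ) (q : B.TotalSpace), B.proj q = f.toAddEquiv x →
      ∃! p, (pullback f B).proj p = x ∧ pullbackMap f B p = q := by
  refine ⟨?_, ?_⟩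
  · rintro ⟨z, v⟩
    rfl
  · intro x q hq
    obtain ⟨z, rfl⟩ := QuotientAddGroup.mk_surjective x
    obtain ⟨⟨Z, v⟩, rfl⟩ := Quotient.exists_rep q
    obtain ⟨γ, hγ⟩ : ∃ γ, period τ' γ = -Z + f.lin z := QuotientAddGroup.eq.1 hq
    refine ⟨(pullback f B).pt z (B.factor γ Z *ᵥ v), ⟨rfl, ?_⟩, ?_⟩
    · exact Quotient.sound (B.setoid.symm ⟨γ, by simp [hγ]⟩)
    · rintro ⟨z', v'⟩ ⟨h1, h2⟩
      obtain ⟨δ, hδ⟩ : ∃ δ, period τ δ = -z' + z := QuotientAddGroup.eq.1 h1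
      obtain ⟨ε, hε⟩ := Quotient.exact h2
      obtain ⟨h3, h4⟩ := Prod.ext_iff.1 hε
      simp only at h3 h4
      subst h3 h4
      obtain rfl : z = z' + period τ δ := by rw [hδ]; abel
      have h5 : γ + ε = f.per δ := by
        apply hτ'
        rw [map_add, hγ, map_add, f.lin_period]
        abel
      refine Quotient.sound ⟨δ, ?_⟩
      simp [pullback, ← h5, B.factor_add, Matrix.mulVec_mulVec]

/-- An isomorphism of smooth vector bundles with connection: a homeomorphism of the total spaces
over the torus that lifts to `(z, v) ↦ (z, Ψ(z) v)` for a smooth matrix function `Ψ` (its local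
expression), and that carries the connection to the connection: `∇ ∘ Ψ = Ψ ∘ ∇`. -/
structure Iso (B C : TorusBundle τ N) where
  toHomeomorph : B.TotalSpace ≃ₜ C.TotalSpace
  proj_comp : ∀ p, C.proj (toHomeomorph p) = B.proj p
  lift : (Fin n → ℂ) → Matrix (Fin N) (Fin N) ℂ
  lift_smooth : ∀ i j, ContDiff ℝ ∞ (fun z => lift z i j)
  map_mk : ∀ z v, toHomeomorph (B.pt z v) = C.pt z (lift z *ᵥ v)
  parallel : ∀ z v i j,
    fderiv ℝ (fun w => lift w i j) z v + (C.conn z v * lift z) i j = (lift z * B.conn z v) i j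

end TorusBundle

/-! ### Real coordinates and the isomorphism `φ` -/

section Coordinates

variable {n : ℕ}

/-- The real coordinate `Y` of `Z = X + τ Y`. -/
noncomputable def coordY (τ : Matrix (Fin n) (Fin n) ℂ) : (Fin n → ℂ) →ₗ[ℝ] (Fin n → ℝ) where
  toFun Z := (τ.map Complex.im)⁻¹ *ᵥ (fun i => (Z i).im)
  map_add' Z W := by rw [← Matrix.mulVec_add]; rfl
  map_smul' c Z := by
    rw [RingHom.id_apply, ← Matrix.mulVec_smul]
    congr 1
    ext i
    simp

/-- The real coordinate `X` of `Z = X + τ Y`. -/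
noncomputable def coordX (τ : Matrix (Fin n) (Fin n) ℂ) : (Fin n → ℂ) →ₗ[ℝ] (Fin n → ℝ) where
  toFun Z := (fun i => (Z i).re) - τ.map Complex.re *ᵥ coordY τ Z
  map_add' Z W := by
    rw [map_add, Matrix.mulVec_add]
    ext i
    simp
    ring
  map_smul' c Z := by
    rw [map_smul, Matrix.mulVec_smul]
    ext i
    simp
    ring

theorem coord_spec {τ : Matrix (Fin n) (Fin n) ℂ} (hτ : (τ.map Complex.im).det ≠ 0)
    (Z : Fin n → ℂ) (X Y : Fin n → ℝ) :
    (fun i => (X i : ℂ)) + τ *ᵥ (fun i => (Y i : ℂ)) = Z ↔ X = coordX τ Z ∧ Y = coordY τ Z := by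
  have hu : IsUnit (τ.map Complex.im).det := isUnit_iff_ne_zero.2 hτ
  have key : (fun i => (X i : ℂ)) + τ *ᵥ (fun i => (Y i : ℂ)) = Z ↔
      (X + τ.map Complex.re *ᵥ Y = fun i => (Z i).re) ∧
        (τ.map Complex.im *ᵥ Y = fun i => (Z i).im) := by
    simp only [funext_iff, ← forall_and]
    refine forall_congr' fun i => ?_
    simp [Complex.ext_iff, Matrix.mulVec, dotProduct]
  have hY : (τ.map Complex.im *ᵥ Y = fun i => (Z i).im) ↔ Y = coordY τ Z := by
    constructor
    · intro h
      change Y = (τ.map Complex.im)⁻¹ *ᵥ (fun i => (Z i).im)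
      rw [← h, Matrix.mulVec_mulVec, Matrix.nonsing_inv_mul _ hu, Matrix.one_mulVec]
    · rintro rfl
      change τ.map Complex.im *ᵥ ((τ.map Complex.im)⁻¹ *ᵥ (fun i => (Z i).im)) = _
      rw [Matrix.mulVec_mulVec, Matrix.mul_nonsing_inv _ hu, Matrix.one_mulVec]
  rw [key, hY]
  constructor
  · rintro ⟨h, rfl⟩
    exact ⟨eq_sub_of_add_eq h, rfl⟩
  · rintro ⟨rfl, rfl⟩
    exact ⟨sub_add_cancel _ _, rfl⟩

theorem coord_period {τ : Matrix (Fin n) (Fin n) ℂ} (hτ : (τ.map Complex.im).det ≠ 0)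
    (γ : Period n) :
    coordX τ (period τ γ) = (fun i => 2 * Real.pi * (γ.1 i : ℝ)) ∧
      coordY τ (period τ γ) = (fun i => 2 * Real.pi * (γ.2 i : ℝ)) := by
  have h := (coord_spec hτ (period τ γ) (fun i => 2 * Real.pi * (γ.1 i : ℝ))
    (fun i => 2 * Real.pi * (γ.2 i : ℝ))).1 (by
      ext i
      simp [period, Matrix.mulVec, dotProduct, Finset.mul_sum]
      refine Finset.sum_congr rfl fun j _ => by ring)
  exact ⟨h.1.symm, h.2.symm⟩

theorem period_injective {τ : Matrix (Fin n) (Fin n) ℂ} (hτ : (τ.map Complex.im).det ≠ 0) :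
    Function.Injective (period τ) := by
  intro γ γ' h
  have h1 := coord_period hτ γ
  rw [h] at h1
  have h2 := coord_period hτ γ'
  have e1 := h1.1.symm.trans h2.1
  have e2 := h1.2.symm.trans h2.2
  have hpi : (2 * Real.pi) ≠ 0 := by positivity
  ext i
  · simpa [hpi] using congrFun e1 i
  · simpa [hpi] using congrFun e2 i

/-- An integer matrix as a complex matrix. -/
def toC (M : Matrix (Fin n) (Fin n) ℤ) : Matrix (Fin n) (Fin n) ℂ := M.map (Int.cast : ℤ → ℂ)

/-- `T' = (-T + δ)⁻¹`. -/
noncomputable def primed (T : Matrix (Fin n) (Fin n) ℂ) (δ : Matrix (Fin n) (Fin n) ℤ) :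
    Matrix (Fin n) (Fin n) ℂ :=
  (-T + toC δ)⁻¹

theorem det_neg_add_ne_zero {T : Matrix (Fin n) (Fin n) ℂ} {δ : Matrix (Fin n) (Fin n) ℤ}
    (h : (T - toC δ).det ≠ 0) : IsUnit (-T + toC δ).det := by
  have : -T + toC δ = -(T - toC δ) := by abel
  rw [this, Matrix.det_neg]
  exact isUnit_iff_ne_zero.2 (mul_ne_zero (pow_ne_zero _ (by simp)) h)

/-- The imaginary part of `T'` is invertible when that of `T` is. -/
theorem primed_im_det_ne_zero {T : Matrix (Fin n) (Fin n) ℂ} {δ : Matrix (Fin n) (Fin n) ℤ}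
    (hT : (T.map Complex.im).det ≠ 0) (h : (T - toC δ).det ≠ 0) :
    ((primed T δ).map Complex.im).det ≠ 0 := by
  have hu := det_neg_add_ne_zero h
  intro h0
  obtain ⟨v, hv, hv0⟩ := Matrix.exists_mulVec_eq_zero_iff.2 h0
  -- `T' v` is a real vector `w`, and then `v = (-T + δ) w` has imaginary part `-(Im T) w`
  set w : Fin n → ℝ := (primed T δ).map Complex.re *ᵥ v with hw
  have h1 : primed T δ *ᵥ (fun i => (v i : ℂ)) = fun i => (w i : ℂ) := by
    ext i
    have := congrFun hv0 i
    simp [Matrix.mulVec, dotProduct] at this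
    apply Complex.ext
    · simp [hw, Matrix.mulVec, dotProduct]
    · simp [Matrix.mulVec, dotProduct, this]
  have h2 : (-T + toC δ) *ᵥ (fun i => (w i : ℂ)) = fun i => (v i : ℂ) := by
    rw [← h1, primed, Matrix.mulVec_mulVec, Matrix.mul_nonsing_inv _ hu, Matrix.one_mulVec]
  have h3 : T.map Complex.im *ᵥ w = 0 := by
    ext i
    have := congrArg Complex.im (congrFun h2 i)
    simpa [Matrix.mulVec, dotProduct, toC] using this
  have h4 : w = 0 := Matrix.eq_zero_of_mulVec_eq_zero hT h3
  apply hv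
  ext i
  have := congrFun h2 i
  simp [h4, Matrix.mulVec, dotProduct] at this
  simpa using this.symm

/-- The biholomorphic map `φ(z) = (-T + δ)⁻¹ z` from the torus of `T` to the torus of `T'`; on
periods it is `(a, b) ↦ (-b, a + δ b)`. -/
noncomputable def phi (T : Matrix (Fin n) (Fin n) ℂ) (δ : Matrix (Fin n) (Fin n) ℤ)
    (h : (T - toC δ).det ≠ 0) : TorusIso T (primed T δ) where
  lin := LinearEquiv.ofLinearMap (Matrix.mulVecLin (primed T δ)) (Matrix.mulVecLin (-T + toC δ))
    (by
      rw [← Matrix.mulVecLin_mul, primed, Matrix.nonsing_inv_mul _ (det_neg_add_ne_zero h),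
        Matrix.mulVecLin_one])
    (by
      rw [← Matrix.mulVecLin_mul, primed, Matrix.mul_nonsing_inv _ (det_neg_add_ne_zero h),
        Matrix.mulVecLin_one])
  per :=
    { toFun := fun γ => (-γ.2, γ.1 + δ *ᵥ γ.2)
      invFun := fun γ => (γ.2 + δ *ᵥ γ.1, -γ.1)
      left_inv := fun γ => by simp [Matrix.mulVec_neg]
      right_inv := fun γ => by simp [Matrix.mulVec_neg]
      map_add' := fun γ γ' => by
        ext i
        · simp [add_comm]
        · simp [Matrix.mulVec_add]
          ring }
  lin_period γ := by
    have hδ : (fun i => ((γ.1 + δ *ᵥ γ.2) i : ℂ))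
        = (fun i => (γ.1 i : ℂ)) + toC δ *ᵥ (fun i => (γ.2 i : ℂ)) := by
      ext i
      simp [Matrix.mulVec, dotProduct, toC]
    have hn : (fun i => (((-γ.2) i : ℤ) : ℂ)) = -(fun i => (γ.2 i : ℂ)) := by
      ext i
      simp
    change primed T δ *ᵥ ((2 * (Real.pi : ℂ)) • _) = (2 * (Real.pi : ℂ)) • (_ + _)
    rw [Matrix.mulVec_smul]
    congr 1
    change _ = (fun i => (((-γ.2) i : ℤ) : ℂ)) + primed T δ *ᵥ (fun i => ((γ.1 + δ *ᵥ γ.2) i : ℂ))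
    rw [hδ, hn]
    have e : (fun i => (γ.1 i : ℂ)) + T *ᵥ (fun i => (γ.2 i : ℂ))
        = (fun i => (γ.1 i : ℂ)) + toC δ *ᵥ (fun i => (γ.2 i : ℂ))
          - (-T + toC δ) *ᵥ (fun i => (γ.2 i : ℂ)) := by
      rw [Matrix.add_mulVec, Matrix.neg_mulVec]
      abel
    rw [e, Matrix.mulVec_sub, Matrix.mulVec_mulVec, primed,
      Matrix.nonsing_inv_mul _ (det_neg_add_ne_zero h), Matrix.one_mulVec]
    abel

end Coordinates

/-! ### Elementary divisors and the rank `r'` -/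

/-- Invertible integer matrices `P`, `Q` with `P A Q` diagonal, the diagonal entries being
natural numbers each of which divides the next (zeros come last). -/
structure SmithForm {n : ℕ} (A : Matrix (Fin n) (Fin n) ℤ) where
  P : GL (Fin n) ℤ
  Q : GL (Fin n) ℤ
  d : Fin n → ℕ
  dvd : ∀ i j, i ≤ j → d i ∣ d j
  eq : (P : Matrix (Fin n) (Fin n) ℤ) * A * (Q : Matrix (Fin n) (Fin n) ℤ)
    = Matrix.diagonal (fun i => (d i : ℤ))

/-- `r' = ∏ rᵢ'`, where `rᵢ' = r / gcd(r, dᵢ)` is the denominator of `dᵢ / r` in lowest terms;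
zero entries contribute the factor `1`. -/
def SmithForm.rank {n : ℕ} {A : Matrix (Fin n) (Fin n) ℤ} (S : SmithForm A) (r : ℕ) : ℕ :=
  ∏ i, r / Nat.gcd r (S.d i)

section Smith

theorem smith_pivot {m : Type*} [Fintype m] [DecidableEq m] (A : Matrix m m ℤ) (hA : A ≠ 0) :
    ∃ P Q : Matrix m m ℤ, IsUnit P.det ∧ IsUnit Q.det ∧ ∃ i₀ j₀, (P * A * Q) i₀ j₀ ≠ 0 ∧
      ∀ i j, (P * A * Q) i₀ j₀ ∣ (P * A * Q) i j := by
  classical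
  let good : ℕ → Prop := fun k => 0 < k ∧ ∃ P Q : Matrix m m ℤ, IsUnit P.det ∧ IsUnit Q.det ∧
    ∃ i j, ((P * A * Q) i j).natAbs = k
  have hex : ∃ k, good k := by
    obtain ⟨i, j, hij⟩ : ∃ i j, A i j ≠ 0 := by
      by_contra! h
      exact hA (Matrix.ext h)
    exact ⟨(A i j).natAbs, Int.natAbs_pos.2 hij, 1, 1, by simp, by simp, i, j, by simp⟩
  have hmin : ∀ P Q : Matrix m m ℤ, IsUnit P.det → IsUnit Q.det → ∀ i j,
      ((P * A * Q) i j).natAbs < Nat.find hex → (P * A * Q) i j = 0 := by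
    intro P Q hP hQ i j hlt
    by_contra h
    exact Nat.find_min hex hlt ⟨Int.natAbs_pos.2 h, P, Q, hP, hQ, i, j, rfl⟩
  obtain ⟨hpos, P, Q, hP, hQ, i₀, j₀, hk⟩ := Nat.find_spec hex
  have hne : ∀ P Q : Matrix m m ℤ, ∀ i j, ((P * A * Q) i j).natAbs = Nat.find hex →
      (P * A * Q) i j ≠ 0 := by
    intro P Q i j h h0
    rw [h0] at h
    simp at h
    omega
  have hmod : ∀ x y : ℤ, y ≠ 0 → (x % y).natAbs < y.natAbs := by
    intro x y hy
    have h1 := Int.emod_nonneg x hy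
    have h2 := Int.emod_lt_abs x hy
    rw [Int.abs_eq_natAbs] at h2
    omega
  -- a minimal entry divides its column and its row
  have hcol : ∀ P Q : Matrix m m ℤ, IsUnit P.det → IsUnit Q.det → ∀ i j,
      ((P * A * Q) i j).natAbs = Nat.find hex → ∀ i', (P * A * Q) i j ∣ (P * A * Q) i' j := by
    intro P Q hP hQ i j h i'
    rcases eq_or_ne i' i with rfl | hi
    · exact dvd_rfl
    · have hd : IsUnit (Matrix.transvection i' i
          (-((P * A * Q) i' j / (P * A * Q) i j)) * P).det := by
        rw [Matrix.det_mul, Matrix.det_transvection_of_ne _ _ hi, one_mul]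
        exact hP
      have e : (Matrix.transvection i' i (-((P * A * Q) i' j / (P * A * Q) i j)) * P * A * Q) i' j
          = (P * A * Q) i' j % (P * A * Q) i j := by
        rw [Matrix.mul_assoc, Matrix.mul_assoc, ← Matrix.mul_assoc P,
          Matrix.transvection_mul_apply_same, Int.emod_def]
        ring
      have := hmin _ Q hd hQ i' j (by rw [e, ← h]; exact hmod _ _ (hne _ _ _ _ h))
      rw [e] at this
      exact Int.dvd_of_emod_eq_zero this
  have hrow : ∀ P Q : Matrix m m ℤ, IsUnit P.det → IsUnit Q.det → ∀ i j,
      ((P * A * Q) i j).natAbs = Nat.find hex → ∀ j', (P * A * Q) i j ∣ (P * A * Q) i j' := by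
    intro P Q hP hQ i j h j'
    rcases eq_or_ne j' j with rfl | hj
    · exact dvd_rfl
    · have hd : IsUnit (Q * Matrix.transvection j j'
          (-((P * A * Q) i j' / (P * A * Q) i j))).det := by
        rw [Matrix.det_mul, Matrix.det_transvection_of_ne _ _ hj.symm, mul_one]
        exact hQ
      have e : (P * A * (Q * Matrix.transvection j j' (-((P * A * Q) i j' / (P * A * Q) i j)))) i j'
          = (P * A * Q) i j' % (P * A * Q) i j := by
        rw [← Matrix.mul_assoc, Matrix.mul_transvection_apply_same, Int.emod_def]
        ring
      have := hmin P _ hP hd i j' (by rw [e, ← h]; exact hmod _ _ (hne _ _ _ _ h))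
      rw [e] at this
      exact Int.dvd_of_emod_eq_zero this
  refine ⟨P, Q, hP, hQ, i₀, j₀, hne _ _ _ _ hk, fun i j => ?_⟩
  rcases eq_or_ne i i₀ with rfl | hi
  · exact hrow P Q hP hQ _ _ hk j
  · obtain ⟨k, hk'⟩ := hcol P Q hP hQ _ _ hk i
    have hd : IsUnit (Matrix.transvection i i₀ (1 - k) * P).det := by
      rw [Matrix.det_mul, Matrix.det_transvection_of_ne _ _ hi, one_mul]
      exact hP
    have e : ∀ j, (Matrix.transvection i i₀ (1 - k) * P * A * Q) i j
        = (P * A * Q) i j + (1 - k) * (P * A * Q) i₀ j := by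
      intro j
      rw [Matrix.mul_assoc, Matrix.mul_assoc, ← Matrix.mul_assoc P,
        Matrix.transvection_mul_apply_same]
    have e1 : (Matrix.transvection i i₀ (1 - k) * P * A * Q) i j₀ = (P * A * Q) i₀ j₀ := by
      rw [e, hk']
      ring
    have h1 := hrow _ Q hd hQ i j₀ (by rw [e1, hk]) j
    rw [e1, e] at h1
    exact (dvd_add_left ((hrow P Q hP hQ _ _ hk j).mul_left _)).1 h1

/-- The block matrix with rows `(1, b)` and `(c, M)`. -/
def corner {n : ℕ} (b c : Fin n → ℤ) (M : Matrix (Fin n) (Fin n) ℤ) :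
    Matrix (Fin (n + 1)) (Fin (n + 1)) ℤ :=
  Matrix.of (Fin.cons (Fin.cons 1 b) fun i => Fin.cons (c i) (M i))

theorem det_corner_left {n : ℕ} (c : Fin n → ℤ) (M : Matrix (Fin n) (Fin n) ℤ) :
    (corner 0 c M).det = M.det := by
  rw [Matrix.det_succ_row_zero, Fin.sum_univ_succ]
  simp [corner, Matrix.submatrix]
  rfl

theorem det_corner_right {n : ℕ} (b : Fin n → ℤ) (M : Matrix (Fin n) (Fin n) ℤ) :
    (corner b 0 M).det = M.det := by
  rw [Matrix.det_succ_column_zero, Fin.sum_univ_succ]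
  simp [corner, Matrix.submatrix]
  rfl

/-- Every integer matrix has such a diagonal form. -/
theorem smith_exists (n : ℕ) (A : Matrix (Fin n) (Fin n) ℤ) :
    ∃ P Q : Matrix (Fin n) (Fin n) ℤ, IsUnit P.det ∧ IsUnit Q.det ∧ ∃ d : Fin n → ℕ,
      (∀ i j, i ≤ j → d i ∣ d j) ∧ P * A * Q = Matrix.diagonal (fun i => (d i : ℤ)) := by
  induction n with
  | zero => exact ⟨1, 1, by simp, by simp, fun _ => 0, fun i => i.elim0, Matrix.ext fun i => i.elim0⟩
  | succ n ih =>
    rcases eq_or_ne A 0 with rfl | hA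
    · exact ⟨1, 1, by simp, by simp, fun _ => 0, fun _ _ _ => dvd_rfl, by ext i j; simp [Matrix.diagonal]⟩
    obtain ⟨P, Q, hP, hQ, i₀, j₀, hne, hdvd⟩ := smith_pivot A hA
    -- move the pivot to the corner, by a permutation of the rows and of the columns
    set p := (P * A * Q) i₀ j₀ with hp
    choose C hC using hdvd
    have hC0 : C i₀ j₀ = 1 := by
      have := hC i₀ j₀
      rw [← hp] at this
      exact (mul_right_cancel₀ hne (by rw [mul_comm, ← this, one_mul]))
    let σ := Equiv.swap 0 i₀
    let π := Equiv.swap 0 j₀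
    let D : Matrix (Fin (n + 1)) (Fin (n + 1)) ℤ := Matrix.of fun i j => C (σ i) (π j)
    have hD0 : D 0 0 = 1 := by simp [D, σ, π, hC0]
    have hD : (σ.permMatrix ℤ) * (P * A * Q) * (π.permMatrix ℤ) = p • D := by
      ext i j
      simp [Equiv.Perm.permMatrix, PEquiv.toMatrix_toPEquiv_mul, PEquiv.mul_toMatrix_toPEquiv,
        D, hC, π]
    -- clear the first column and the first row
    let L := corner 0 (fun i => -D i.succ 0) 1
    let R := corner (fun j => -D 0 j.succ) 0 1
    let D' : Matrix (Fin n) (Fin n) ℤ :=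
      Matrix.of fun i j => D i.succ j.succ - D i.succ 0 * D 0 j.succ
    have hLR : L * D * R = corner 0 0 D' := by
      have h1 : L * D = corner (fun j => D 0 j.succ) 0 D' := by
        ext i j
        refine Fin.cases ?_ (fun i => ?_) i <;> refine Fin.cases ?_ (fun j => ?_) j <;>
          simp [L, corner, Matrix.mul_apply, Fin.sum_univ_succ, hD0, D', Matrix.one_apply]
        ring
      rw [h1]
      ext i j
      refine Fin.cases ?_ (fun i => ?_) i <;> refine Fin.cases ?_ (fun j => ?_) j <;>
        simp [R, corner, Matrix.mul_apply, Fin.sum_univ_succ, Matrix.one_apply]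
    obtain ⟨P', Q', hP', hQ', d, hd, hdiag⟩ := ih D'
    have hfin : corner 0 0 P' * (L * D * R) * corner 0 0 Q'
        = corner 0 0 (Matrix.diagonal fun i => (d i : ℤ)) := by
      rw [hLR, ← hdiag]
      have hmul : ∀ M M' : Matrix (Fin n) (Fin n) ℤ,
          corner 0 0 M * corner 0 0 M' = corner 0 0 (M * M') := by
        intro M M'
        ext i j
        refine Fin.cases ?_ (fun i => ?_) i <;> refine Fin.cases ?_ (fun j => ?_) j <;>
          simp [corner, Matrix.mul_apply, Fin.sum_univ_succ]
      rw [hmul, hmul]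
    have hperm : ∀ τ : Equiv.Perm (Fin (n + 1)), IsUnit (τ.permMatrix ℤ).det := by
      intro τ
      rw [Matrix.det_permutation]
      exact (Units.isUnit _)
    have hs : IsUnit p.sign := by
      rcases lt_or_gt_of_ne hne with h | h
      · simp [Int.sign_eq_neg_one_of_neg h]
      · simp [Int.sign_eq_one_of_pos h]
    refine ⟨p.sign • (corner 0 0 P' * L * σ.permMatrix ℤ * P),
      Q * π.permMatrix ℤ * R * corner 0 0 Q', ?_, ?_,
      Fin.cons p.natAbs (fun i => p.natAbs * d i), ?_, ?_⟩
    · rw [Matrix.det_smul, Matrix.det_mul, Matrix.det_mul, Matrix.det_mul, det_corner_left,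
        det_corner_left, Matrix.det_one]
      exact (hs.pow _).mul (((hP'.mul isUnit_one).mul (hperm _)).mul hP)
    · rw [Matrix.det_mul, Matrix.det_mul, Matrix.det_mul, det_corner_left,
        det_corner_right, Matrix.det_one]
      exact ((hQ.mul (hperm _)).mul isUnit_one).mul hQ'
    · intro i j
      refine Fin.cases ?_ (fun i => ?_) i <;> refine Fin.cases ?_ (fun j => ?_) j
      · simp
      · simp
      · intro h
        exact absurd h (by simp)
      · intro h
        simpa using mul_dvd_mul_left p.natAbs (hd i j (by simpa using h))
    · have e : p.sign • (corner 0 0 P' * L * σ.permMatrix ℤ * P) * A *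
          (Q * π.permMatrix ℤ * R * corner 0 0 Q')
          = (p.sign * p) • (corner 0 0 P' * (L * D * R) * corner 0 0 Q') := by
        have : corner 0 0 P' * L * σ.permMatrix ℤ * P * A * (Q * π.permMatrix ℤ * R * corner 0 0 Q')
            = corner 0 0 P' * L * ((σ.permMatrix ℤ) * (P * A * Q) * (π.permMatrix ℤ)) * R *
              corner 0 0 Q' := by
          simp only [Matrix.mul_assoc]
        rw [smul_mul_assoc, smul_mul_assoc, this, hD]
        simp only [Matrix.mul_smul, Matrix.smul_mul, smul_smul, Matrix.mul_assoc]
      rw [e, hfin, Int.sign_mul_self_eq_natAbs]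
      ext i j
      refine Fin.cases ?_ (fun i => ?_) i <;> refine Fin.cases ?_ (fun j => ?_) j <;>
        simp [corner, Matrix.diagonal_apply, (Fin.succ_ne_zero _).symm]

theorem SmithForm.nonempty {n : ℕ} (A : Matrix (Fin n) (Fin n) ℤ) : Nonempty (SmithForm A) := by
  obtain ⟨P, Q, hP, hQ, d, hd, h⟩ := smith_exists n A
  exact ⟨⟨Matrix.GeneralLinearGroup.mk'' P hP, Matrix.GeneralLinearGroup.mk'' Q hQ, d, hd, h⟩⟩

end Smith

/-! ### Products of powers -/

section Powers

variable {G : Type*} [Group G]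

/-- The ordered product `∏ⱼ gⱼ ^ aⱼ`. -/
def powProd {n : ℕ} (g : Fin n → G) (a : Fin n → ℤ) : G :=
  (List.ofFn fun j => g j ^ a j).prod

theorem prod_ofFn_mul {n : ℕ} (f g : Fin n → G) (h : ∀ i j, Commute (g i) (f j)) :
    (List.ofFn fun j => f j * g j).prod = (List.ofFn f).prod * (List.ofFn g).prod := by
  induction n with
  | zero => simp
  | succ n ih =>
    simp only [List.ofFn_succ, List.prod_cons]
    rw [ih (fun j => f j.succ) (fun j => g j.succ) (fun i j => h _ _)]
    have hc : Commute (g 0) (List.ofFn fun j : Fin n => f j.succ).prod := by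
      refine Commute.list_prod_right _ _ fun x hx => ?_
      obtain ⟨j, rfl⟩ := (List.mem_ofFn' _ _).1 hx
      exact h _ _
    simp only [mul_assoc]
    congr 1
    simp only [← mul_assoc]
    rw [hc.eq]

theorem powProd_add {n : ℕ} (g : Fin n → G) (h : ∀ i j, Commute (g i) (g j)) (a b : Fin n → ℤ) :
    powProd g (a + b) = powProd g a * powProd g b := by
  unfold powProd
  rw [← prod_ofFn_mul _ _ (fun i j => (h i j).zpow_zpow _ _)]
  simp only [Pi.add_apply, _root_.zpow_add]

theorem powProd_zero {n : ℕ} (g : Fin n → G) : powProd g 0 = 1 := by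
  simp [powProd]

theorem powProd_single {n : ℕ} (g : Fin n → G) (k : Fin n) : powProd g (Pi.single k 1) = g k := by
  have : (fun j => g j ^ (Pi.single k 1 : Fin n → ℤ) j) = Pi.mulSingle k (g k) := by
    ext j
    by_cases hj : j = k
    · subst hj; simp
    · simp [hj]
  rw [powProd, this]
  clear this
  induction n with
  | zero => exact k.elim0
  | succ n ih =>
    rw [List.ofFn_succ, List.prod_cons]
    refine Fin.cases ?_ (fun k => ?_) k
    · have : (fun i : Fin n => (Pi.mulSingle 0 (g 0) : Fin (n + 1) → G) i.succ) = fun _ => 1 := by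
        ext i
        simp
      rw [this]
      simp
    · have : (fun i : Fin n => (Pi.mulSingle k.succ (g k.succ) : Fin (n + 1) → G) i.succ)
          = Pi.mulSingle k (g k.succ) := by
        ext i
        simp [Pi.mulSingle_apply]
      rw [this, ih (fun j => g j.succ) k]
      simp

/-- If `x gⱼ x⁻¹ = cⱼ gⱼ` with `cⱼ` central, then `x g^a x⁻¹ = c^a g^a`. -/
theorem conj_powProd {n : ℕ} (g c : Fin n → G) (x : G) (hc : ∀ j y, Commute (c j) y)
    (h : ∀ j, x * g j * x⁻¹ = c j * g j) (a : Fin n → ℤ) :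
    x * powProd g a * x⁻¹ = powProd c a * powProd g a := by
  have h1 : x * powProd g a * x⁻¹ = (List.ofFn fun j => (c j * g j) ^ a j).prod := by
    rw [powProd, ← MulAut.conj_apply, map_list_prod, List.map_ofFn]
    congr 2
    ext j
    simp only [Function.comp, map_zpow, MulAut.conj_apply, h]
  rw [h1, powProd, powProd, ← prod_ofFn_mul]
  · congr 2
    ext j
    exact (hc j (g j)).mul_zpow _
  · intro i j
    exact ((hc j _).zpow_left _).symm

end Powers

section Scalars

variable {N : ℕ}

/-- The scalar unitary matrix `e^{it}`. -/
noncomputable def phase (N : ℕ) (t : ℝ) : Matrix.unitaryGroup (Fin N) ℂ :=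
  ⟨Complex.exp (t * I) • 1, by
    rw [Matrix.mem_unitaryGroup_iff, Matrix.star_eq_conjTranspose, Matrix.conjTranspose_smul,
      Matrix.conjTranspose_one, smul_mul_smul_comm, mul_one, RCLike.star_def, ← Complex.exp_conj,
      ← Complex.exp_add]
    simp⟩

theorem phase_coe (t : ℝ) :
    (phase N t : Matrix (Fin N) (Fin N) ℂ) = Complex.exp (t * I) • 1 := rfl

theorem phase_commute (t : ℝ) (x : Matrix.unitaryGroup (Fin N) ℂ) : Commute (phase N t) x := by
  apply Subtype.ext
  simp [phase_coe]

theorem phase_add (s t : ℝ) : phase N (s + t) = phase N s * phase N t := by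
  apply Subtype.ext
  rw [Submonoid.coe_mul, phase_coe, phase_coe, phase_coe, Complex.ofReal_add, add_mul,
    Complex.exp_add, smul_mul_smul_comm, mul_one]

theorem phase_zero : phase N 0 = 1 := by
  apply Subtype.ext
  simp [phase_coe]

theorem phase_zpow (t : ℝ) (m : ℤ) : phase N t ^ m = phase N (m * t) := by
  let f : Multiplicative ℝ →* Matrix.unitaryGroup (Fin N) ℂ :=
    { toFun := fun t => phase N t.toAdd
      map_one' := phase_zero
      map_mul' := fun s t => phase_add _ _ }
  have := map_zpow f (Multiplicative.ofAdd t) m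
  simpa [f, toAdd_zpow] using this.symm

theorem powProd_phase {n : ℕ} (t : Fin n → ℝ) (a : Fin n → ℤ) :
    powProd (fun j => phase N (t j)) a = phase N (∑ j, a j * t j) := by
  simp only [powProd, phase_zpow]
  induction n with
  | zero => simp [phase_zero]
  | succ n ih =>
    rw [List.ofFn_succ, List.prod_cons, Fin.sum_univ_succ, phase_add,
      ih (fun j => t j.succ) (fun j => a j.succ)]

end Scalars

/-! ### The bundles `E_{(r,A,μ,𝒰)}` -/

/-- `ζ = e^{2πi/r}`. -/
noncomputable def zetaRoot (r : ℕ) : ℂ := Complex.exp (2 * Real.pi * I / r)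

/-- Unitary matrices `V_j`, `U_k` of order `N` with the cocycle condition
`V_j V_k = V_k V_j`, `U_j U_k = U_k U_j`, `ζ^{-a_{kj}} U_k V_j = V_j U_k`. -/
@[ext]
structure SYZUnitaries {n : ℕ} (r : ℕ) (A : Matrix (Fin n) (Fin n) ℤ) (N : ℕ) where
  V : Fin n → Matrix.unitaryGroup (Fin N) ℂ
  U : Fin n → Matrix.unitaryGroup (Fin N) ℂ
  V_comm : ∀ j k, V j * V k = V k * V j
  U_comm : ∀ j k, U j * U k = U k * U j
  U_V : ∀ j k, zetaRoot r ^ (-(A k j)) • ((U k : Matrix (Fin N) (Fin N) ℂ) * (V j : Matrix _ _ ℂ))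
    = (V j : Matrix (Fin N) (Fin N) ℂ) * (U k : Matrix _ _ ℂ)

theorem SYZUnitaries.mul_pow {n r N : ℕ} {A : Matrix (Fin n) (Fin n) ℤ}
    (𝒰 : SYZUnitaries r A N) (a b : Fin n → ℤ) :
    powProd 𝒰.U b * powProd 𝒰.V a
      = phase N (2 * Real.pi / r * ∑ k, ∑ j, b k * A k j * a j)
        * (powProd 𝒰.V a * powProd 𝒰.U b) := by
  have h1 : ∀ j k, 𝒰.U k * 𝒰.V j * (𝒰.U k)⁻¹ = phase N (2 * Real.pi / r * A k j) * 𝒰.V j := by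
    intro j k
    rw [mul_inv_eq_iff_eq_mul]
    apply Subtype.ext
    have h := 𝒰.U_V j k
    have e : zetaRoot r ^ (-(A k j)) = Complex.exp (-((2 * Real.pi / r * A k j : ℝ) * I)) := by
      rw [zetaRoot, ← Complex.exp_int_mul]
      congr 1
      push_cast
      ring
    rw [e] at h
    simp only [Submonoid.coe_mul, phase_coe, smul_mul_assoc, one_mul, ← h, smul_smul,
      ← Complex.exp_add]
    simp
  have h2 : ∀ k, 𝒰.U k * powProd 𝒰.V a * (𝒰.U k)⁻¹
      = phase N (∑ j, a j * (2 * Real.pi / r * A k j)) * powProd 𝒰.V a := by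
    intro k
    rw [conj_powProd 𝒰.V _ (𝒰.U k) (fun j y => phase_commute _ y) (fun j => h1 j k) a,
      powProd_phase]
  have h3 : ∀ k, (powProd 𝒰.V a)⁻¹ * 𝒰.U k * (powProd 𝒰.V a)⁻¹⁻¹
      = phase N (∑ j, a j * (2 * Real.pi / r * A k j)) * 𝒰.U k := by
    intro k
    have := h2 k
    rw [mul_inv_eq_iff_eq_mul] at this
    rw [inv_inv, mul_assoc, this, mul_assoc, (phase_commute _ _).eq, ← mul_assoc,
      inv_mul_cancel_left, ← (phase_commute _ _).eq]
  have h4 := conj_powProd 𝒰.U _ (powProd 𝒰.V a)⁻¹ (fun j y => phase_commute _ y) h3 b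
  rw [powProd_phase, inv_inv, mul_assoc, inv_mul_eq_iff_eq_mul] at h4
  rw [h4, ← mul_assoc, ← (phase_commute _ _).eq, mul_assoc]
  congr 2
  push_cast
  rw [Finset.mul_sum]
  refine Finset.sum_congr rfl fun k _ => ?_
  rw [Finset.mul_sum, Finset.mul_sum]
  refine Finset.sum_congr rfl fun j _ => by ring

section Bundles

variable {n N : ℕ}

theorem expLin_smooth (l : (Fin n → ℂ) →ₗ[ℝ] ℂ) (k : ℂ) (M : Matrix (Fin N) (Fin N) ℂ)
    (i j : Fin N) : ContDiff ℝ ∞ (fun z => (Complex.exp (l z + k) • M) i j) := by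
  have hl : ContDiff ℝ ∞ (fun z => l z) := l.toContinuousLinearMap.contDiff
  simp only [Matrix.smul_apply, smul_eq_mul]
  exact ((hl.add contDiff_const).cexp).mul contDiff_const

theorem expLin_conn (l : (Fin n → ℂ) →ₗ[ℝ] ℂ) (k : ℂ) (M : Matrix (Fin N) (Fin N) ℂ)
    (z v : Fin n → ℂ) (c c' : ℂ) (h : l v + c' = c) (i j : Fin N) :
    fderiv ℝ (fun w => (Complex.exp (l w + k) • M) i j) z v
      + ((c' • (1 : Matrix (Fin N) (Fin N) ℂ)) * (Complex.exp (l z + k) • M)) i j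
      = ((Complex.exp (l z + k) • M) * (c • (1 : Matrix (Fin N) (Fin N) ℂ))) i j := by
  have hl : HasFDerivAt (fun w => l w) l.toContinuousLinearMap z :=
    l.toContinuousLinearMap.hasFDerivAt
  have h1 := (((hl.add_const k).cexp).mul_const (M i j)).fderiv
  simp only [Matrix.smul_apply, smul_eq_mul]
  rw [h1]
  simp [← h]
  ring

/-- The part of the exponent of the factor of automorphy that is linear in `Z`. -/
noncomputable def syzExp (τ : Matrix (Fin n) (Fin n) ℂ) (r : ℕ) (A : Matrix (Fin n) (Fin n) ℤ)
    (a : Fin n → ℤ) : (Fin n → ℂ) →ₗ[ℝ] ℂ where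
  toFun Z := I / r * ∑ j, ∑ i, (a j : ℂ) * A i j * coordY τ Z i
  map_add' Z W := by
    rw [← mul_add, ← Finset.sum_add_distrib]
    congr 1
    refine Finset.sum_congr rfl fun j _ => ?_
    rw [← Finset.sum_add_distrib]
    refine Finset.sum_congr rfl fun i _ => ?_
    simp
    ring
  map_smul' c Z := by
    simp only [map_smul, Pi.smul_apply, smul_eq_mul, Complex.real_smul, Complex.ofReal_mul,
      Finset.mul_sum, RingHom.id_apply]
    refine Finset.sum_congr rfl fun j _ => Finset.sum_congr rfl fun i _ => by ring

theorem syzExp_spec (τ : Matrix (Fin n) (Fin n) ℂ) (r : ℕ) (A : Matrix (Fin n) (Fin n) ℤ)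
    (a b : Fin n → ℤ) (Z : Fin n → ℂ) :
    I / r * ∑ j, ∑ i, (a j : ℂ) * A i j * (coordY τ Z i + 2 * Real.pi * b i)
      = syzExp τ r A a Z + I / r * ∑ j, ∑ i, (a j : ℂ) * A i j * (2 * Real.pi * b i) := by
  simp only [syzExp, LinearMap.coe_mk, AddHom.coe_mk]
  rw [← mul_add, ← Finset.sum_add_distrib]
  congr 1
  refine Finset.sum_congr rfl fun j _ => ?_
  rw [← Finset.sum_add_distrib]
  refine Finset.sum_congr rfl fun i _ => by ring

/-- The bundle `E_{(r,A,μ,𝒰)}` on the torus of `τ` with its connection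
`d - (i/2π)((1/r) Xᵗ Aᵗ + (1/r) μᵗ) dY`. Its factor of automorphy is the one determined by
`s(X + 2π e_j, Y) = e^{(i/r) a_j Y} V_j s(X, Y)` and `s(X, Y + 2π e_k) = U_k s(X, Y)`, where `a_j`
is the `j`-th column of `A`. -/
noncomputable def syzBundle (τ : Matrix (Fin n) (Fin n) ℂ) (hτ : (τ.map Complex.im).det ≠ 0)
    (r : ℕ) (A : Matrix (Fin n) (Fin n) ℤ) (μ : Fin n → ℂ) (𝒰 : SYZUnitaries r A N) :
    TorusBundle τ N where
  factor γ Z :=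
    Complex.exp (I / r * ∑ j, ∑ i, (γ.1 j : ℂ) * A i j * (coordY τ Z i + 2 * Real.pi * γ.2 i)) •
      ((powProd 𝒰.V γ.1 * powProd 𝒰.U γ.2 : Matrix.unitaryGroup (Fin N) ℂ) :
        Matrix (Fin N) (Fin N) ℂ)
  conn Z :=
    { toFun := fun v =>
        (-(I / (2 * Real.pi * r)) * ∑ i, (∑ j, (A i j : ℂ) * coordX τ Z j + μ i) * coordY τ v i) • 1
      map_add' := fun v w => by
        rw [← add_smul, ← mul_add, ← Finset.sum_add_distrib]
        simp [mul_add]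
      map_smul' := fun c v => by
        rw [RingHom.id_apply, ← smul_assoc]
        congr 1
        simp only [map_smul, Pi.smul_apply, smul_eq_mul, Complex.real_smul, Complex.ofReal_mul,
          Finset.mul_sum]
        refine Finset.sum_congr rfl fun i _ => by ring }
  factor_zero Z := by simp [powProd_zero]
  factor_add γ γ' Z := by
    have hY : ∀ i, coordY τ (Z + period τ γ') i = coordY τ Z i + 2 * Real.pi * γ'.2 i := by
      intro i
      rw [map_add, (coord_period hτ γ').2]
      rfl
    have hm : (powProd 𝒰.V (γ + γ').1 * powProd 𝒰.U (γ + γ').2 : Matrix.unitaryGroup (Fin N) ℂ)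
        = phase N (-(2 * Real.pi / r * ∑ k, ∑ j, γ.2 k * A k j * γ'.1 j)) *
          ((powProd 𝒰.V γ.1 * powProd 𝒰.U γ.2) * (powProd 𝒰.V γ'.1 * powProd 𝒰.U γ'.2)) := by
      have e : (powProd 𝒰.V γ.1 * powProd 𝒰.U γ.2) * (powProd 𝒰.V γ'.1 * powProd 𝒰.U γ'.2)
          = phase N (2 * Real.pi / r * ∑ k, ∑ j, γ.2 k * A k j * γ'.1 j) *
            (powProd 𝒰.V γ.1 * powProd 𝒰.V γ'.1 * (powProd 𝒰.U γ.2 * powProd 𝒰.U γ'.2)) := by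
        have := 𝒰.mul_pow γ'.1 γ.2
        calc _ = powProd 𝒰.V γ.1 * (powProd 𝒰.U γ.2 * powProd 𝒰.V γ'.1) * powProd 𝒰.U γ'.2 := by
              simp only [mul_assoc]
          _ = _ := by
              rw [this, ← mul_assoc (powProd 𝒰.V γ.1), ← (phase_commute _ _).eq]
              simp only [mul_assoc]
      rw [e, ← mul_assoc, ← phase_add, neg_add_cancel, phase_zero, one_mul, Prod.fst_add,
        Prod.snd_add, powProd_add _ 𝒰.V_comm, powProd_add _ 𝒰.U_comm]
    rw [hm, Submonoid.coe_mul, phase_coe, smul_mul_assoc, one_mul, smul_smul, smul_mul_smul_comm,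
      ← Submonoid.coe_mul, ← Complex.exp_add, ← Complex.exp_add]
    congr 2
    simp only [hY]
    have hs : (∑ k, ∑ j, (γ.2 k : ℂ) * A k j * γ'.1 j)
        = ∑ j, ∑ i, (γ'.1 j : ℂ) * A i j * γ.2 i := by
      rw [Finset.sum_comm]
      refine Finset.sum_congr rfl fun j _ => Finset.sum_congr rfl fun i _ => by ring
    push_cast
    rw [hs]
    have e1 : ∀ (x : ℂ), -(2 * (Real.pi : ℂ) / r * x) * I = I / r * (-(2 * Real.pi) * x) := by
      intro x; ring
    rw [e1, ← mul_add, ← mul_add]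
    congr 1
    rw [Finset.mul_sum, ← Finset.sum_add_distrib, ← Finset.sum_add_distrib]
    refine Finset.sum_congr rfl fun j _ => ?_
    rw [Finset.mul_sum, ← Finset.sum_add_distrib, ← Finset.sum_add_distrib]
    refine Finset.sum_congr rfl fun i _ => ?_
    simp
    ring
  factor_smooth γ i j := by
    simp only [syzExp_spec]
    exact expLin_smooth _ _ _ _ _
  conn_smooth v i j := by
    have hX : ∀ k, ContDiff ℝ ∞ (fun Z => (coordX τ Z k : ℂ)) := fun k =>
      Complex.ofRealCLM.contDiff.comp
        ((contDiff_apply ℝ ℝ k).comp (coordX τ).toContinuousLinearMap.contDiff)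
    simp only [LinearMap.coe_mk, AddHom.coe_mk, Matrix.smul_apply, smul_eq_mul]
    refine (contDiff_const.mul (ContDiff.sum fun k _ => ?_)).mul contDiff_const
    refine ((ContDiff.sum fun l _ => ?_).add contDiff_const).mul contDiff_const
    exact contDiff_const.mul (hX l)
  conn_factor γ Z v i j := by
    simp only [syzExp_spec, LinearMap.coe_mk, AddHom.coe_mk]
    refine expLin_conn _ _ _ _ _ _ _ ?_ i j
    have hX : ∀ k, coordX τ (Z + period τ γ) k = coordX τ Z k + 2 * Real.pi * γ.1 k := by
      intro k
      rw [map_add, (coord_period hτ γ).1]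
      rfl
    have hpi : (Real.pi : ℂ) ≠ 0 := by exact_mod_cast Real.pi_ne_zero
    simp only [hX, syzExp, LinearMap.coe_mk, AddHom.coe_mk]
    rw [Finset.sum_comm, Finset.mul_sum, Finset.mul_sum, Finset.mul_sum, ← Finset.sum_add_distrib]
    refine Finset.sum_congr rfl fun k _ => ?_
    have e : ∑ l, (A k l : ℂ) * ((coordX τ Z l + 2 * Real.pi * γ.1 l : ℝ) : ℂ)
        = ∑ l, (A k l : ℂ) * coordX τ Z l + 2 * Real.pi * ∑ l, (γ.1 l : ℂ) * A k l := by
      rw [Finset.mul_sum, ← Finset.sum_add_distrib]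
      refine Finset.sum_congr rfl fun l _ => ?_
      push_cast
      ring
    rw [e, ← Finset.sum_mul]
    have e2 : I / (2 * Real.pi * r) * (2 * Real.pi) = I / r := by
      rcases eq_or_ne (r : ℂ) 0 with h | h
      · simp [h]
      · field_simp
    rw [← e2]
    ring

/-- The transition functions in the coordinate directions. -/
theorem syzBundle_factor (τ : Matrix (Fin n) (Fin n) ℂ) (hτ : (τ.map Complex.im).det ≠ 0)
    (r : ℕ) (A : Matrix (Fin n) (Fin n) ℤ) (μ : Fin n → ℂ) (𝒰 : SYZUnitaries r A N)
    (Z : Fin n → ℂ) (k : Fin n) :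
    (syzBundle τ hτ r A μ 𝒰).factor (Pi.single k 1, 0) Z
        = Complex.exp (I / r * ∑ i, (A i k : ℂ) * coordY τ Z i) • (𝒰.V k : Matrix _ _ ℂ) ∧
      (syzBundle τ hτ r A μ 𝒰).factor (0, Pi.single k 1) Z = (𝒰.U k : Matrix _ _ ℂ) := by
  constructor
  · have : ∑ j, ∑ i, (((Pi.single k 1 : Fin n → ℤ) j : ℤ) : ℂ) * A i j *
        (coordY τ Z i + 2 * Real.pi * ((0 : Fin n → ℤ) i : ℂ))
        = ∑ i, (A i k : ℂ) * coordY τ Z i := by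
      rw [Finset.sum_eq_single k]
      · simp
      · intro j _ hj
        simp [hj]
      · simp
    simp only [syzBundle, this, powProd_single, powProd_zero, mul_one]
  · simp [syzBundle, powProd_single, powProd_zero]

end Bundles

/-! ### The bundles `ℰ_{(r,A,μ,𝒰)}` -/

section ProjectivelyFlat

variable {n N : ℕ}

/-- The entrywise complex conjugate. -/
def cbar (M : Matrix (Fin n) (Fin n) ℂ) : Matrix (Fin n) (Fin n) ℂ := M.map conj

/-- `(T - T̄)⁻¹`. -/
noncomputable def diffInv (T : Matrix (Fin n) (Fin n) ℂ) : Matrix (Fin n) (Fin n) ℂ :=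
  (T - cbar T)⁻¹

/-- `R = (i/2π)(N/r) ((T - T̄)⁻¹)ᵗ Aᵗ`. -/
noncomputable def matR (T : Matrix (Fin n) (Fin n) ℂ) (r : ℕ) (A : Matrix (Fin n) (Fin n) ℤ)
    (N : ℕ) : Matrix (Fin n) (Fin n) ℂ :=
  (I / (2 * Real.pi) * (N / r)) • ((diffInv T)ᵀ * (toC A)ᵀ)

/-- `ℛ(z, w) = ∑ R_{ij} z_i w̄_j`. -/
noncomputable def formR (T : Matrix (Fin n) (Fin n) ℂ) (r : ℕ) (A : Matrix (Fin n) (Fin n) ℤ)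
    (N : ℕ) (z w : Fin n → ℂ) : ℂ :=
  ∑ i, ∑ j, matR T r A N i j * z i * conj (w j)

/-- `j(γ, z) = U(γ) exp{(1/N) ℛ(z, γ) + (1/2N) ℛ(γ, γ)}`. -/
noncomputable def autJ (T : Matrix (Fin n) (Fin n) ℂ) (r : ℕ) (A : Matrix (Fin n) (Fin n) ℤ)
    (U : Period n → Matrix.unitaryGroup (Fin N) ℂ) (γ : Period n) (z : Fin n → ℂ) :
    Matrix (Fin N) (Fin N) ℂ :=
  Complex.exp (1 / N * formR T r A N z (period T γ)
    + 1 / (2 * N) * formR T r A N (period T γ) (period T γ)) • (U γ : Matrix (Fin N) (Fin N) ℂ)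

/-- Unitary matrices `U(γ)`, one for each lattice vector `γ`, for which `j` is a factor of
automorphy. -/
@[ext]
structure AutFactor (T : Matrix (Fin n) (Fin n) ℂ) (r : ℕ) (A : Matrix (Fin n) (Fin n) ℤ)
    (N : ℕ) where
  U : Period n → Matrix.unitaryGroup (Fin N) ℂ
  cocycle : ∀ γ γ' z,
    autJ T r A U (γ + γ') z = autJ T r A U γ (z + period T γ') * autJ T r A U γ' z

/-- Unitary matrices `U(γ_j)` (here `W j`) and `U(γ'_k)` (here `W' k`) of order `N` with
`U(γ_j) U(γ_k) = U(γ_k) U(γ_j)`,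
`U(γ'_j) U(γ'_k) = ζ^{(Aᵗδ)_{jk} - (Aᵗδ)_{kj}} U(γ'_k) U(γ'_j)` and
`ζ^{-a_{jk}} U(γ'_k) U(γ_j) = U(γ_j) U(γ'_k)`. -/
@[ext]
structure AutUnitaries (δ : Matrix (Fin n) (Fin n) ℤ) (r : ℕ) (A : Matrix (Fin n) (Fin n) ℤ)
    (N : ℕ) where
  W : Fin n → Matrix.unitaryGroup (Fin N) ℂ
  W' : Fin n → Matrix.unitaryGroup (Fin N) ℂ
  W_comm : ∀ j k, W j * W k = W k * W j
  W'_comm : ∀ j k, (W' j : Matrix (Fin N) (Fin N) ℂ) * (W' k : Matrix _ _ ℂ)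
    = zetaRoot r ^ ((Aᵀ * δ) j k - (Aᵀ * δ) k j) •
      ((W' k : Matrix (Fin N) (Fin N) ℂ) * (W' j : Matrix _ _ ℂ))
  W'_W : ∀ j k, zetaRoot r ^ (-(A j k)) •
      ((W' k : Matrix (Fin N) (Fin N) ℂ) * (W j : Matrix _ _ ℂ))
    = (W j : Matrix (Fin N) (Fin N) ℂ) * (W' k : Matrix _ _ ℂ)

/-- The values of `U` on the generators `γ_j = 2π e_j`, `γ'_k = 2π T e_k` are the given
matrices. -/
def AutFactor.Extends {T : Matrix (Fin n) (Fin n) ℂ} {δ : Matrix (Fin n) (Fin n) ℤ} {r : ℕ}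
    {A : Matrix (Fin n) (Fin n) ℤ} (ρ : AutFactor T r A N) (𝒲 : AutUnitaries δ r A N) : Prop :=
  (∀ j, ρ.U (Pi.single j 1, 0) = 𝒲.W j) ∧ ∀ k, ρ.U (0, Pi.single k 1) = 𝒲.W' k

theorem formR_add_left (T : Matrix (Fin n) (Fin n) ℂ) (r : ℕ) (A : Matrix (Fin n) (Fin n) ℤ)
    (z z' w : Fin n → ℂ) :
    formR T r A N (z + z') w = formR T r A N z w + formR T r A N z' w := by
  simp only [formR, ← Finset.sum_add_distrib]
  refine Finset.sum_congr rfl fun i _ => Finset.sum_congr rfl fun j _ => ?_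
  rw [Pi.add_apply]
  ring

theorem formR_add_right (T : Matrix (Fin n) (Fin n) ℂ) (r : ℕ) (A : Matrix (Fin n) (Fin n) ℤ)
    (z w w' : Fin n → ℂ) :
    formR T r A N z (w + w') = formR T r A N z w + formR T r A N z w' := by
  simp only [formR, ← Finset.sum_add_distrib]
  refine Finset.sum_congr rfl fun i _ => Finset.sum_congr rfl fun j _ => ?_
  rw [Pi.add_apply, map_add]
  ring

theorem formR_smul_left (T : Matrix (Fin n) (Fin n) ℂ) (r : ℕ) (A : Matrix (Fin n) (Fin n) ℤ)
    (c : ℂ) (z w : Fin n → ℂ) :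
    formR T r A N (c • z) w = c * formR T r A N z w := by
  simp only [formR, Finset.mul_sum]
  refine Finset.sum_congr rfl fun i _ => Finset.sum_congr rfl fun j _ => ?_
  rw [Pi.smul_apply, smul_eq_mul]
  ring

/-- The bundle `ℰ_{(r,A,μ,𝒰)}` on the torus of `T` with factor of automorphy `j` and connection
form `-(1/N) dzᵗ R z̄ - (i/2πr) μᵗ (δ - T̄)(T - T̄)⁻¹ dz + (i/2πr) μ̄ᵗ (δ - T̄)(T - T̄)⁻¹ dz`. -/
noncomputable def flatBundle (T : Matrix (Fin n) (Fin n) ℂ) (δ : Matrix (Fin n) (Fin n) ℤ) (r : ℕ)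
    (A : Matrix (Fin n) (Fin n) ℤ) (μ : Fin n → ℂ) (ρ : AutFactor T r A N) :
    TorusBundle T N where
  factor := autJ T r A ρ.U
  conn z :=
    { toFun := fun v =>
        (-(1 / N * formR T r A N v z)
          - I / (2 * Real.pi * r) * (μ ⬝ᵥ ((toC δ - cbar T) * diffInv T) *ᵥ v)
          + I / (2 * Real.pi * r) * (star μ ⬝ᵥ ((toC δ - cbar T) * diffInv T) *ᵥ v)) • 1
      map_add' := fun v w => by
        rw [← add_smul, formR_add_left, Matrix.mulVec_add, dotProduct_add, dotProduct_add]
        congr 1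
        ring
      map_smul' := fun c v => by
        have hc : c • v = (c : ℂ) • v := by
          ext i
          simp
        rw [RingHom.id_apply, ← smul_assoc, hc, formR_smul_left, Matrix.mulVec_smul,
          dotProduct_smul, dotProduct_smul, Complex.real_smul]
        congr 1
        simp only [smul_eq_mul]
        ring }
  factor_zero z := by
    have h : ρ.U 0 = 1 := by
      have h0 := ρ.cocycle 0 0 0
      simp only [autJ, formR, map_zero, Pi.zero_apply, add_zero, mul_zero, Finset.sum_const_zero,
        Complex.exp_zero, one_smul, ← Submonoid.coe_mul] at h0
      simpa using Subtype.ext h0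
    simp [autJ, formR, h]
  factor_add := ρ.cocycle
  factor_smooth γ i j := by
    let l : (Fin n → ℂ) →ₗ[ℝ] ℂ :=
      { toFun := fun z => 1 / N * formR T r A N z (period T γ)
        map_add' := fun z w => by rw [formR_add_left, mul_add]
        map_smul' := fun c z => by
          have hc : c • z = (c : ℂ) • z := by
            ext i
            simp
          rw [hc, formR_smul_left, RingHom.id_apply, Complex.real_smul]
          ring }
    exact expLin_smooth l _ _ i j
  conn_smooth v i j := by
    simp only [LinearMap.coe_mk, AddHom.coe_mk, Matrix.smul_apply, smul_eq_mul]
    refine (ContDiff.add (ContDiff.sub (contDiff_const.mul ?_).neg contDiff_const)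
      contDiff_const).mul contDiff_const
    unfold formR
    refine ContDiff.sum fun k _ => ContDiff.sum fun m _ => contDiff_const.mul ?_
    exact Complex.conjCLE.contDiff.comp (contDiff_apply ℝ ℂ m)
  conn_factor γ z v i j := by
    let l : (Fin n → ℂ) →ₗ[ℝ] ℂ :=
      { toFun := fun z => 1 / N * formR T r A N z (period T γ)
        map_add' := fun z w => by rw [formR_add_left, mul_add]
        map_smul' := fun c z => by
          have hc : c • z = (c : ℂ) • z := by
            ext i
            simp
          rw [hc, formR_smul_left, RingHom.id_apply, Complex.real_smul]
          ring }
    refine expLin_conn l _ _ z v _ _ ?_ i j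
    simp only [l, LinearMap.coe_mk, AddHom.coe_mk, formR_add_right]
    ring

/-- `𝒜 = (N/r) ((T - T̄)⁻¹)ᵗ Aᵗ (δ - T) (T - T̄)⁻¹`. -/
noncomputable def calA (T : Matrix (Fin n) (Fin n) ℂ) (δ : Matrix (Fin n) (Fin n) ℤ) (r : ℕ)
    (A : Matrix (Fin n) (Fin n) ℤ) (N : ℕ) : Matrix (Fin n) (Fin n) ℂ :=
  ((N : ℂ) / r) • ((diffInv T)ᵀ * (toC A)ᵀ * (toC δ - T) * diffInv T)

/-- The scalar factor of `Ψ(z, z̄)`. -/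
noncomputable def psi (T : Matrix (Fin n) (Fin n) ℂ) (δ : Matrix (Fin n) (Fin n) ℤ) (r : ℕ)
    (A : Matrix (Fin n) (Fin n) ℤ) (μ : Fin n → ℂ) (N : ℕ) (z : Fin n → ℂ) : ℂ :=
  Complex.exp (
    I / (4 * Real.pi * N) * (z ⬝ᵥ cbar (calA T δ r A N) *ᵥ z)
    + I / (4 * Real.pi * N) * (star z ⬝ᵥ calA T δ r A N *ᵥ star z)
    - I / (2 * Real.pi * N) * (z ⬝ᵥ calA T δ r A N *ᵥ star z)
    + I / (2 * Real.pi * r) * (star z ⬝ᵥ ((diffInv T)ᵀ * (toC δ - T)ᵀ) *ᵥ μ)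
    - I / (2 * Real.pi * r) * (z ⬝ᵥ ((diffInv T)ᵀ * (toC δ - cbar T)ᵀ) *ᵥ star μ))

end ProjectivelyFlat

/-- If `xᵗ (Im T) x > 0` for all real `x ≠ 0`, then `Im T` is invertible. -/
theorem im_det_ne_zero {n : ℕ} {T : Matrix (Fin n) (Fin n) ℂ}
    (hT : ∀ x : Fin n → ℝ, x ≠ 0 → 0 < x ⬝ᵥ T.map Complex.im *ᵥ x) :
    (T.map Complex.im).det ≠ 0 := by
  intro h
  obtain ⟨v, hv, h0⟩ := Matrix.exists_mulVec_eq_zero_iff.2 h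
  have := hT v hv
  rw [h0, dotProduct_zero] at this
  exact lt_irrefl _ this

/-- The pullback bundle `φ^*E_{(r,A,μ,𝒰)}` on the torus of `T`, where `E_{(r,A,μ,𝒰)}` is the bundle
on the torus of `T' = (-T + δ)⁻¹`. -/
noncomputable def pulledBundle {n N : ℕ} (T : Matrix (Fin n) (Fin n) ℂ)
    (hT : (T.map Complex.im).det ≠ 0) (δ : Matrix (Fin n) (Fin n) ℤ) (hδ : (T - toC δ).det ≠ 0)
    (r : ℕ) (A : Matrix (Fin n) (Fin n) ℤ) (μ : Fin n → ℂ) (𝒰 : SYZUnitaries r A N) :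
    TorusBundle T N :=
  (syzBundle (primed T δ) (primed_im_det_ne_zero hT hδ) r A μ 𝒰).pullback (phi T δ hδ)

/-!
Write `X(z)`, `Y(z)` for the real coordinates of `φ(z) = X + T'Y`; they are real linear in `z`. Up
to the constant `i/2πr`, the connection form of `φ^*E` at `z` is `v ↦ -((A X(z))ᵗ Y(v) + μᵗ Y(v))`
and `log Ψ` is a linear form plus half of the difference of the quadratic forms `zᵗ((T-T̄)⁻¹)ᵗAᵗz̄`
and `(A X(z))ᵗ Y(z)`. The symmetry of `AT'` says that `𝒜` is symmetric, which makes `d log Ψ` the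
difference of the two connection forms. For the same reason, transforming the transition functions
of `φ^*E` by `Ψ` leaves `exp {ℛ(z,γ)/r' + ℛ(γ,γ)/2r'}` times a unitary matrix `U(γ)` independent
of `z`, and this is a factor of automorphy because the transition functions of `φ^*E` are.

By construction `U(γ)` is a phase times a product of powers of the `V_j` and `U_k`. On the
generators, up to these phases, `U(γ_j) = U_j` and `U(γ'_k) = V_k⁻¹ ∏ₗ U_l ^ δ_{lk}`, and that this
is a bijection between the two kinds of families is a statement about elements of a group which
commute up to powers of a central `ζ`.
-/

section Conjugation

variable {n : ℕ}

theorem cbar_mul (M M' : Matrix (Fin n) (Fin n) ℂ) : cbar (M * M') = cbar M * cbar M' :=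
  map_mul (starRingEnd ℂ).mapMatrix M M'

theorem cbar_sub (M M' : Matrix (Fin n) (Fin n) ℂ) : cbar (M - M') = cbar M - cbar M' :=
  map_sub (starRingEnd ℂ).mapMatrix M M'

theorem cbar_cbar (M : Matrix (Fin n) (Fin n) ℂ) : cbar (cbar M) = M := by
  ext i j
  exact Complex.conj_conj _

theorem cbar_toC (M : Matrix (Fin n) (Fin n) ℤ) : cbar (toC M) = toC M := by
  ext i j
  exact map_intCast (starRingEnd ℂ) _

theorem star_mulVec_eq_cbar (M : Matrix (Fin n) (Fin n) ℂ) (z : Fin n → ℂ) :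
    star (M *ᵥ z) = cbar M *ᵥ star z := by
  rw [Matrix.star_mulVec, ← Matrix.mulVec_transpose]
  rfl

theorem conj_dotProduct (z w : Fin n → ℂ) : conj (z ⬝ᵥ w) = star z ⬝ᵥ star w := by
  rw [Matrix.star_dotProduct_star, dotProduct_comm]
  rfl

theorem cbar_isSymm {M : Matrix (Fin n) (Fin n) ℂ} (hM : M.IsSymm) : (cbar M).IsSymm :=
  hM.map conj

theorem sub_cbar_det_ne_zero {T : Matrix (Fin n) (Fin n) ℂ} (hT : (T.map Complex.im).det ≠ 0) :
    (T - cbar T).det ≠ 0 := by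
  have h : T - cbar T = (2 * I) • Complex.ofRealHom.mapMatrix (T.map Complex.im) := by
    ext i j
    simp only [cbar, Matrix.sub_apply, Matrix.map_apply, Complex.sub_conj, Matrix.smul_apply,
      RingHom.mapMatrix_apply, Complex.ofRealHom_eq_coe, smul_eq_mul]
    push_cast
    ring
  rw [h, Matrix.det_smul, ← RingHom.map_det]
  exact mul_ne_zero (pow_ne_zero _ (by simp)) (Complex.ofReal_ne_zero.2 hT)

theorem diffInv_mul {T : Matrix (Fin n) (Fin n) ℂ} (hT : (T.map Complex.im).det ≠ 0) :
    diffInv T * (T - cbar T) = 1 :=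
  Matrix.nonsing_inv_mul _ (sub_cbar_det_ne_zero hT).isUnit

theorem mul_diffInv {T : Matrix (Fin n) (Fin n) ℂ} (hT : (T.map Complex.im).det ≠ 0) :
    (T - cbar T) * diffInv T = 1 :=
  Matrix.mul_nonsing_inv _ (sub_cbar_det_ne_zero hT).isUnit

theorem cbar_diffInv {T : Matrix (Fin n) (Fin n) ℂ} (hT : (T.map Complex.im).det ≠ 0) :
    cbar (diffInv T) = -diffInv T := by
  have h : -cbar (diffInv T) * (T - cbar T) = 1 := by
    calc -cbar (diffInv T) * (T - cbar T) = cbar (diffInv T * (T - cbar T)) := by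
          rw [cbar_mul, cbar_sub, cbar_cbar, ← neg_sub T, mul_neg, neg_mul]
      _ = 1 := by rw [diffInv_mul hT]; exact map_one (starRingEnd ℂ).mapMatrix
  exact neg_eq_iff_eq_neg.1 (Matrix.inv_eq_left_inv h).symm

end Conjugation

section PulledCoordinates

variable {n : ℕ}

/-- The matrix `(δ - T̄)(T - T̄)⁻¹` of the holomorphic part of `z ↦ Y(φ(z))`. -/
noncomputable def holY (T : Matrix (Fin n) (Fin n) ℂ) (δ : Matrix (Fin n) (Fin n) ℤ) :
    Matrix (Fin n) (Fin n) ℂ :=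
  (toC δ - cbar T) * diffInv T

/-- The matrix `(δ - T)(T - T̄)⁻¹`, minus the antiholomorphic part of `z ↦ Y(φ(z))`. -/
noncomputable def antiholY (T : Matrix (Fin n) (Fin n) ℂ) (δ : Matrix (Fin n) (Fin n) ℤ) :
    Matrix (Fin n) (Fin n) ℂ :=
  (toC δ - T) * diffInv T

/-- The real coordinate `X` of `φ(z)`, with real vectors embedded in `ℂⁿ`. -/
noncomputable def pulledX (T : Matrix (Fin n) (Fin n) ℂ) : (Fin n → ℂ) →ₗ[ℝ] (Fin n → ℂ) where
  toFun z := -(diffInv T *ᵥ (z - star z))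
  map_add' z w := by
    simp only [star_add, Matrix.mulVec_sub, Matrix.mulVec_add]
    abel
  map_smul' c z := by
    simp only [star_smul, star_trivial, ← smul_sub, Matrix.mulVec_smul, smul_neg, RingHom.id_apply]

/-- The real coordinate `Y` of `φ(z)`, with real vectors embedded in `ℂⁿ`. -/
noncomputable def pulledY (T : Matrix (Fin n) (Fin n) ℂ) (δ : Matrix (Fin n) (Fin n) ℤ) :
    (Fin n → ℂ) →ₗ[ℝ] (Fin n → ℂ) where
  toFun z := holY T δ *ᵥ z - antiholY T δ *ᵥ star z
  map_add' z w := by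
    simp only [star_add, Matrix.mulVec_add]
    abel
  map_smul' c z := by
    simp only [star_smul, star_trivial, Matrix.mulVec_smul, ← smul_sub, RingHom.id_apply]

theorem pulledX_apply (T : Matrix (Fin n) (Fin n) ℂ) (z : Fin n → ℂ) :
    pulledX T z = -(diffInv T *ᵥ (z - star z)) :=
  rfl

theorem pulledY_apply (T : Matrix (Fin n) (Fin n) ℂ) (δ : Matrix (Fin n) (Fin n) ℤ)
    (z : Fin n → ℂ) : pulledY T δ z = holY T δ *ᵥ z - antiholY T δ *ᵥ star z :=
  rfl

variable {T : Matrix (Fin n) (Fin n) ℂ} {δ : Matrix (Fin n) (Fin n) ℤ}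

theorem holY_eq_one_add (hT : (T.map Complex.im).det ≠ 0) : holY T δ = 1 + antiholY T δ := by
  rw [holY, antiholY, ← mul_diffInv hT, ← Matrix.add_mul, add_comm, sub_add_sub_cancel]

theorem cbar_antiholY (hT : (T.map Complex.im).det ≠ 0) : cbar (antiholY T δ) = -holY T δ := by
  rw [antiholY, cbar_mul, cbar_sub, cbar_toC, cbar_diffInv hT, mul_neg, holY]

theorem cbar_holY (hT : (T.map Complex.im).det ≠ 0) : cbar (holY T δ) = -antiholY T δ := by
  rw [holY, cbar_mul, cbar_sub, cbar_toC, cbar_cbar, cbar_diffInv hT, mul_neg, antiholY]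

theorem star_pulledX (hT : (T.map Complex.im).det ≠ 0) (z : Fin n → ℂ) :
    star (pulledX T z) = pulledX T z := by
  rw [pulledX_apply, star_neg, star_mulVec_eq_cbar, cbar_diffInv hT, star_sub, star_star,
    ← neg_sub z, Matrix.neg_mulVec, Matrix.mulVec_neg, neg_neg]

theorem star_pulledY (hT : (T.map Complex.im).det ≠ 0) (z : Fin n → ℂ) :
    star (pulledY T δ z) = pulledY T δ z := by
  rw [pulledY_apply, star_sub, star_mulVec_eq_cbar, star_mulVec_eq_cbar, cbar_holY hT,
    cbar_antiholY hT, star_star, Matrix.neg_mulVec, Matrix.neg_mulVec, neg_sub_neg]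

theorem pulledY_eq_sub_mulVec_pulledX (hT : (T.map Complex.im).det ≠ 0) (z : Fin n → ℂ) :
    pulledY T δ z = z - (toC δ - T) *ᵥ pulledX T z := by
  rw [pulledY_apply, pulledX_apply, holY_eq_one_add hT, antiholY, Matrix.mulVec_neg,
    Matrix.mulVec_mulVec, Matrix.mulVec_sub, Matrix.add_mulVec, Matrix.one_mulVec]
  abel

theorem exists_ofReal_comp_eq_of_star_eq {x : Fin n → ℂ} (hx : star x = x) :
    ∃ a : Fin n → ℝ, (fun i => (a i : ℂ)) = x :=
  ⟨fun i => (x i).re, funext fun i => Complex.conj_eq_iff_re.1 (congrFun hx i)⟩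

theorem primed_mul (hδ : (T - toC δ).det ≠ 0) : primed T δ * (toC δ - T) = 1 := by
  rw [primed, sub_eq_neg_add, Matrix.nonsing_inv_mul _ (det_neg_add_ne_zero hδ)]

theorem coord_phi (hT : (T.map Complex.im).det ≠ 0) (hδ : (T - toC δ).det ≠ 0) (z : Fin n → ℂ) :
    (fun i => (coordX (primed T δ) (primed T δ *ᵥ z) i : ℂ)) = pulledX T z ∧
      (fun i => (coordY (primed T δ) (primed T δ *ᵥ z) i : ℂ)) = pulledY T δ z := by
  obtain ⟨X, hX⟩ := exists_ofReal_comp_eq_of_star_eq (star_pulledX hT z)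
  obtain ⟨Y, hY⟩ := exists_ofReal_comp_eq_of_star_eq (star_pulledY (δ := δ) hT z)
  have hz : primed T δ *ᵥ z = pulledX T z + primed T δ *ᵥ pulledY T δ z := by
    rw [pulledY_eq_sub_mulVec_pulledX hT, Matrix.mulVec_sub, Matrix.mulVec_mulVec, primed_mul hδ,
      Matrix.one_mulVec, add_sub_cancel]
  rw [← hX, ← hY] at hz ⊢
  obtain ⟨hX', hY'⟩ := (coord_spec (primed_im_det_ne_zero hT hδ) (primed T δ *ᵥ z) X Y).1 hz.symm
  simp only [hX', hY', and_self]

end PulledCoordinates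

section Exponent

variable {n : ℕ}

/-- The symmetric matrix `𝒜` without its scalar factor `N/r`. -/
noncomputable def calA₀ (T : Matrix (Fin n) (Fin n) ℂ) (δ A : Matrix (Fin n) (Fin n) ℤ) :
    Matrix (Fin n) (Fin n) ℂ :=
  (toC A * diffInv T)ᵀ * antiholY T δ

/-- The form `(A X)ᵗ Y` in the real coordinates `X` of `φ(z)` and `Y` of `φ(w)`. -/
noncomputable def coordPairing (T : Matrix (Fin n) (Fin n) ℂ) (δ A : Matrix (Fin n) (Fin n) ℤ) :
    (Fin n → ℂ) →ₗ[ℝ] (Fin n → ℂ) →ₗ[ℝ] ℂ :=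
  LinearMap.mk₂ ℝ (fun z w => toC A *ᵥ pulledX T z ⬝ᵥ pulledY T δ w)
    (fun z z' w => by rw [map_add, Matrix.mulVec_add, add_dotProduct])
    (fun c z w => by rw [map_smul, Matrix.mulVec_smul, smul_dotProduct])
    (fun z w w' => by rw [map_add, dotProduct_add])
    (fun c z w => by rw [map_smul, dotProduct_smul])

/-- The sesquilinear form `zᵗ ((T - T̄)⁻¹)ᵗ Aᵗ w̄`, a multiple of `ℛ`. -/
noncomputable def scaledR (T : Matrix (Fin n) (Fin n) ℂ) (A : Matrix (Fin n) (Fin n) ℤ) :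
    (Fin n → ℂ) →ₗ[ℝ] (Fin n → ℂ) →ₗ[ℝ] ℂ :=
  LinearMap.mk₂ ℝ (fun z w => z ⬝ᵥ (toC A * diffInv T)ᵀ *ᵥ star w)
    (fun z z' w => by rw [add_dotProduct])
    (fun c z w => by rw [smul_dotProduct])
    (fun z w w' => by rw [star_add, Matrix.mulVec_add, dotProduct_add])
    (fun c z w => by rw [star_smul, star_trivial, Matrix.mulVec_smul, dotProduct_smul])

/-- The part of the exponent of `Ψ` that is real linear in `z`, divided by `i/2πr`. -/
noncomputable def psiLinear (T : Matrix (Fin n) (Fin n) ℂ) (δ : Matrix (Fin n) (Fin n) ℤ)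
    (μ : Fin n → ℂ) : (Fin n → ℂ) →ₗ[ℝ] ℂ where
  toFun z := μ ⬝ᵥ antiholY T δ *ᵥ star z - star μ ⬝ᵥ holY T δ *ᵥ z
  map_add' z w := by
    simp only [star_add, Matrix.mulVec_add, dotProduct_add]
    ring
  map_smul' c z := by
    simp only [star_smul, star_trivial, Matrix.mulVec_smul, dotProduct_smul, smul_sub,
      RingHom.id_apply]

/-- The exponent of `Ψ`, divided by `i/2πr`. -/
noncomputable def psiExp (T : Matrix (Fin n) (Fin n) ℂ) (δ A : Matrix (Fin n) (Fin n) ℤ)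
    (μ z : Fin n → ℂ) : ℂ :=
  psiLinear T δ μ z + (scaledR T A z z - coordPairing T δ A z z) / 2

theorem coordPairing_apply (T : Matrix (Fin n) (Fin n) ℂ) (δ A : Matrix (Fin n) (Fin n) ℤ)
    (z w : Fin n → ℂ) :
    coordPairing T δ A z w = toC A *ᵥ pulledX T z ⬝ᵥ pulledY T δ w :=
  rfl

theorem scaledR_apply (T : Matrix (Fin n) (Fin n) ℂ) (A : Matrix (Fin n) (Fin n) ℤ)
    (z w : Fin n → ℂ) : scaledR T A z w = z ⬝ᵥ (toC A * diffInv T)ᵀ *ᵥ star w :=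
  rfl

theorem psiLinear_apply (T : Matrix (Fin n) (Fin n) ℂ) (δ : Matrix (Fin n) (Fin n) ℤ)
    (μ z : Fin n → ℂ) :
    psiLinear T δ μ z = μ ⬝ᵥ antiholY T δ *ᵥ star z - star μ ⬝ᵥ holY T δ *ᵥ z :=
  rfl

theorem formR_eq (N r : ℕ) (T : Matrix (Fin n) (Fin n) ℂ) (A : Matrix (Fin n) (Fin n) ℤ)
    (z w : Fin n → ℂ) : formR T r A N z w = N * (I / (2 * Real.pi * r) * scaledR T A z w) := by
  have h : formR T r A N z w = z ⬝ᵥ matR T r A N *ᵥ star w := by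
    simp only [formR, dotProduct, Matrix.mulVec, Finset.mul_sum, Pi.star_apply]
    exact Finset.sum_congr rfl fun i _ => Finset.sum_congr rfl fun j _ => by
      rw [mul_left_comm, mul_assoc]; rfl
  rw [h, matR, ← Matrix.transpose_mul, Matrix.smul_mulVec, dotProduct_smul, ← scaledR_apply,
    smul_eq_mul]
  ring

theorem scaledR_I_smul (T : Matrix (Fin n) (Fin n) ℂ) (A : Matrix (Fin n) (Fin n) ℤ)
    (z w : Fin n → ℂ) :
    scaledR T A (I • z) w = I * scaledR T A z w ∧
      scaledR T A z (I • w) = -(I * scaledR T A z w) := by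
  simp only [scaledR_apply, star_smul, smul_dotProduct, Matrix.mulVec_smul, dotProduct_smul,
    smul_eq_mul]
  simp

theorem calA_eq_smul_calA₀ (T : Matrix (Fin n) (Fin n) ℂ) (δ : Matrix (Fin n) (Fin n) ℤ) (r : ℕ)
    (A : Matrix (Fin n) (Fin n) ℤ) (N : ℕ) : calA T δ r A N = ((N : ℂ) / r) • calA₀ T δ A := by
  rw [calA, calA₀, antiholY, Matrix.transpose_mul, Matrix.mul_assoc]

variable {T : Matrix (Fin n) (Fin n) ℂ} {δ A : Matrix (Fin n) (Fin n) ℤ}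

theorem calA₀_isSymm (hδ : (T - toC δ).det ≠ 0) (hA : (toC A * primed T δ).IsSymm) :
    (calA₀ T δ A).IsSymm := by
  have h : calA₀ T δ A = (antiholY T δ)ᵀ * (toC A * primed T δ) * antiholY T δ := by
    have hD : diffInv T = primed T δ * antiholY T δ := by
      rw [antiholY, ← Matrix.mul_assoc, primed_mul hδ, Matrix.one_mul]
    rw [calA₀, hD, ← Matrix.mul_assoc, Matrix.transpose_mul, hA.eq]
  rw [Matrix.IsSymm, h, Matrix.transpose_mul, Matrix.transpose_mul, hA.eq,
    Matrix.transpose_transpose, ← Matrix.mul_assoc]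

theorem cbar_calA₀ (hT : (T.map Complex.im).det ≠ 0) :
    cbar (calA₀ T δ A) = calA₀ T δ A + (toC A * diffInv T)ᵀ := by
  have h : cbar (toC A * diffInv T)ᵀ = -(toC A * diffInv T)ᵀ := by
    change (cbar (toC A * diffInv T))ᵀ = _
    rw [cbar_mul, cbar_toC, cbar_diffInv hT, mul_neg, Matrix.transpose_neg]
  rw [calA₀, cbar_mul, cbar_antiholY hT, h, neg_mul_neg, holY_eq_one_add hT, Matrix.mul_add,
    Matrix.mul_one, add_comm]

theorem transpose_mul_diffInv (hT : (T.map Complex.im).det ≠ 0) :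
    (toC A * diffInv T)ᵀ = cbar (calA₀ T δ A) - calA₀ T δ A :=
  eq_sub_of_add_eq' (cbar_calA₀ hT).symm

theorem dotProduct_mulVec_comm_of_isSymm {M : Matrix (Fin n) (Fin n) ℂ} (hM : M.IsSymm)
    (z w : Fin n → ℂ) : z ⬝ᵥ M *ᵥ w = w ⬝ᵥ M *ᵥ z := by
  rw [← Matrix.dotProduct_transpose_mulVec, hM.eq]

theorem coordPairing_eq_calA₀ (hT : (T.map Complex.im).det ≠ 0) (z w : Fin n → ℂ) :
    coordPairing T δ A z w = (star z - z) ⬝ᵥ cbar (calA₀ T δ A) *ᵥ w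
      - (star z - z) ⬝ᵥ calA₀ T δ A *ᵥ star w := by
  have hX : toC A *ᵥ pulledX T z = (toC A * diffInv T) *ᵥ (star z - z) := by
    rw [pulledX_apply, ← Matrix.mulVec_neg, neg_sub, Matrix.mulVec_mulVec]
  rw [coordPairing_apply, hX, dotProduct_comm, ← Matrix.dotProduct_transpose_mulVec, pulledY_apply,
    Matrix.mulVec_sub, dotProduct_sub, Matrix.mulVec_mulVec, Matrix.mulVec_mulVec, ← calA₀,
    cbar_calA₀ hT, holY_eq_one_add hT, Matrix.mul_add, Matrix.mul_one, ← calA₀,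
    add_comm (calA₀ _ _ _)]

theorem conj_coordPairing (hT : (T.map Complex.im).det ≠ 0) (z w : Fin n → ℂ) :
    conj (coordPairing T δ A z w) = coordPairing T δ A z w := by
  rw [coordPairing_apply, conj_dotProduct, star_mulVec_eq_cbar, cbar_toC, star_pulledX hT,
    star_pulledY hT]

theorem conj_psiLinear (hT : (T.map Complex.im).det ≠ 0) (μ z : Fin n → ℂ) :
    conj (psiLinear T δ μ z) = psiLinear T δ μ z := by
  simp only [psiLinear_apply, map_sub, conj_dotProduct, star_mulVec_eq_cbar, cbar_holY hT,
    cbar_antiholY hT, star_star, Matrix.neg_mulVec, dotProduct_neg]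
  ring

theorem psiLinear_eq_sub_dotProduct_pulledY (μ z : Fin n → ℂ) :
    psiLinear T δ μ z = (μ - star μ) ⬝ᵥ holY T δ *ᵥ z - μ ⬝ᵥ pulledY T δ z := by
  rw [psiLinear_apply, pulledY_apply, dotProduct_sub, sub_dotProduct]
  ring

/-- The symmetry of `AT'`, as a symmetry of the two forms. -/
theorem scaledR_sub_coordPairing_comm (hT : (T.map Complex.im).det ≠ 0)
    (hs : (calA₀ T δ A).IsSymm) (z w : Fin n → ℂ) :
    scaledR T A w z - coordPairing T δ A z w = scaledR T A z w - coordPairing T δ A w z := by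
  have hc := dotProduct_mulVec_comm_of_isSymm (cbar_isSymm hs)
  simp only [scaledR_apply, coordPairing_eq_calA₀ hT, transpose_mul_diffInv hT (δ := δ),
    Matrix.sub_mulVec, sub_dotProduct, dotProduct_sub]
  linear_combination hc z w - hc (star z) w + hc (star w) z +
    dotProduct_mulVec_comm_of_isSymm hs (star z) (star w)

theorem psiExp_add (hT : (T.map Complex.im).det ≠ 0) (hs : (calA₀ T δ A).IsSymm)
    (μ z w : Fin n → ℂ) :
    psiExp T δ A μ (z + w)
      = psiExp T δ A μ z + psiExp T δ A μ w + (scaledR T A w z - coordPairing T δ A z w) := by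
  simp only [psiExp, map_add, LinearMap.add_apply]
  linear_combination (-1 / 2) * scaledR_sub_coordPairing_comm hT hs z w

theorem psiExp_eq_calA₀ (hT : (T.map Complex.im).det ≠ 0) (hs : (calA₀ T δ A).IsSymm)
    (μ z : Fin n → ℂ) :
    psiExp T δ A μ z = psiLinear T δ μ z + 1 / 2 * (z ⬝ᵥ cbar (calA₀ T δ A) *ᵥ z)
      + 1 / 2 * (star z ⬝ᵥ calA₀ T δ A *ᵥ star z) - z ⬝ᵥ calA₀ T δ A *ᵥ star z := by
  rw [psiExp, coordPairing_eq_calA₀ hT, scaledR_apply, transpose_mul_diffInv hT (δ := δ),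
    Matrix.sub_mulVec, dotProduct_sub, sub_dotProduct, sub_dotProduct,
    dotProduct_mulVec_comm_of_isSymm (cbar_isSymm hs) (star z) z]
  ring

theorem psi_eq_exp_psiExp {N : ℕ} [NeZero N] (hT : (T.map Complex.im).det ≠ 0)
    (hs : (calA₀ T δ A).IsSymm) (r : ℕ) (μ z : Fin n → ℂ) :
    psi T δ r A μ N z = Complex.exp (I / (2 * Real.pi * r) * psiExp T δ A μ z) := by
  have hN : (N : ℂ) ≠ 0 := NeZero.ne _
  have hcbar : cbar (calA T δ r A N) = ((N : ℂ) / r) • cbar (calA₀ T δ A) := by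
    ext i j
    simp [calA_eq_smul_calA₀, cbar]
  rw [psi, ← Matrix.transpose_mul, ← Matrix.transpose_mul, Matrix.dotProduct_transpose_mulVec,
    Matrix.dotProduct_transpose_mulVec, ← antiholY, ← holY, hcbar, calA_eq_smul_calA₀,
    psiExp_eq_calA₀ hT hs, psiLinear_apply]
  simp only [Matrix.smul_mulVec, dotProduct_smul, smul_eq_mul]
  congr 1
  field_simp
  ring

end Exponent

section Derivatives

theorem smul_eq_re_smul_add_im_smul {E : Type*} [AddCommGroup E] [Module ℂ E] (c : ℂ) (w : E) :
    c • w = c.re • w + c.im • I • w := by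
  rw [← Complex.coe_smul, ← Complex.coe_smul, smul_smul, ← add_smul, Complex.re_add_im]

theorem add_I_smul_eq_zero_iff {E : Type*} [AddCommGroup E] [Module ℂ E] {x y : E} :
    x + I • y = 0 ↔ y = I • x := by
  constructor
  · intro h
    rw [eq_neg_of_add_eq_zero_left h, smul_neg, smul_smul, I_mul_I, neg_one_smul, neg_neg]
  · rintro rfl
    rw [smul_smul, I_mul_I, neg_one_smul, add_neg_cancel]

theorem differentiableAt_complex_iff_fderiv_smul_I {E F : Type*} [NormedAddCommGroup E]
    [NormedSpace ℂ E] [NormedAddCommGroup F] [NormedSpace ℂ F] {f : E → F} {z : E}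
    (hf : DifferentiableAt ℝ f z) :
    DifferentiableAt ℂ f z ↔ ∀ v, fderiv ℝ f z (I • v) = I • fderiv ℝ f z v := by
  constructor
  · intro h v
    rw [h.fderiv_restrictScalars ℝ, ContinuousLinearMap.coe_restrictScalars', map_smul]
  · intro hI
    let f' : E →L[ℂ] F :=
      { fderiv ℝ f z with
        map_smul' := fun c v => by
          change fderiv ℝ f z (c • v) = c • fderiv ℝ f z v
          rw [smul_eq_re_smul_add_im_smul c v, map_add, map_smul, map_smul, hI,
            ← smul_eq_re_smul_add_im_smul] }
    exact (differentiableAt_iff_restrictScalars ℝ hf).2 ⟨f', rfl⟩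

theorem hasFDerivAt_mulVec {E m k : Type*} [NormedAddCommGroup E] [NormedSpace ℝ E] [Finite m]
    [Fintype k] {M : E → Matrix m k ℂ} {s : E → k → ℂ} {M' : m → k → E →L[ℝ] ℂ}
    {s' : E →L[ℝ] k → ℂ} {z : E} (hM : ∀ i j, HasFDerivAt (fun w => M w i j) (M' i j) z)
    (hs : HasFDerivAt s s' z) :
    HasFDerivAt (fun w => M w *ᵥ s w) (ContinuousLinearMap.pi fun i => ∑ j,
      (M z i j • (ContinuousLinearMap.proj j).comp s' + s z j • M' i j)) z :=
  have := Fintype.ofFinite m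
  hasFDerivAt_pi.2 fun i => HasFDerivAt.fun_sum fun j _ =>
    (hM i j).fun_mul (hasFDerivAt_pi'.1 hs j)

end Derivatives

namespace TorusBundle

variable {n N : ℕ} {τ : Matrix (Fin n) (Fin n) ℂ} {B C : TorusBundle τ N}

theorem curvature_of_scalar {c : (Fin n → ℂ) → (Fin n → ℂ) → ℂ}
    (hc : ∀ z v, B.conn z v = c z v • 1) (z u v : Fin n → ℂ) :
    B.curvature z u v
      = (fderiv ℝ (fun w => c w v) z u - fderiv ℝ (fun w => c w u) z v) • 1 := by
  ext i j
  simp only [curvature, hc, Matrix.add_apply, Matrix.of_apply, Matrix.smul_apply,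
    smul_mul_smul_comm, mul_comm (c z v), sub_self]
  rcases eq_or_ne i j with rfl | hij
  · simp
  · simp [Matrix.one_apply_ne hij]

theorem pt_eq_zero_iff {z : Fin n → ℂ} {x : Fin N → ℂ} : B.pt z x = B.pt z 0 ↔ x = 0 := by
  refine ⟨fun h => ?_, fun h => h ▸ rfl⟩
  obtain ⟨γ, hγ⟩ : ∃ γ, (z, x) = (z + period τ γ, B.factor γ z *ᵥ 0) := Quotient.exact h.symm
  rw [(Prod.mk.inj hγ).2, Matrix.mulVec_zero]

/-- The map of total spaces `(z, v) ↦ (z, g(z) v)` induced by a scalar function `g`. -/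
def scalarMap (g : (Fin n → ℂ) → ℂ)
    (hf : ∀ γ z, g z • C.factor γ z = g (z + period τ γ) • B.factor γ z) :
    B.TotalSpace → C.TotalSpace :=
  Quotient.map (fun p => (p.1, g p.1 • p.2)) (by
    rintro p q ⟨γ, rfl⟩
    refine ⟨γ, Prod.ext rfl ?_⟩
    simp only [Matrix.mulVec_smul, ← Matrix.smul_mulVec, hf])

theorem continuous_scalarMap {g : (Fin n → ℂ) → ℂ} (hg : Continuous g)
    (hf : ∀ γ z, g z • C.factor γ z = g (z + period τ γ) • B.factor γ z) :
    Continuous (scalarMap g hf) :=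
  Continuous.quotient_map' (continuous_fst.prodMk ((hg.comp continuous_fst).smul continuous_snd)) _

theorem scalarMap_scalarMap {g h : (Fin n → ℂ) → ℂ} (hgh : ∀ z, h z * g z = 1)
    (hf : ∀ γ z, g z • C.factor γ z = g (z + period τ γ) • B.factor γ z)
    (hf' : ∀ γ z, h z • B.factor γ z = h (z + period τ γ) • C.factor γ z) (p : B.TotalSpace) :
    scalarMap h hf' (scalarMap g hf p) = p := by
  obtain ⟨⟨z, v⟩, rfl⟩ := Quotient.exists_rep p
  refine congrArg (Quotient.mk B.setoid) (Prod.ext rfl ?_)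
  exact (smul_smul _ _ _).trans (by rw [hgh, one_smul])

theorem factor_gauge_symm {g : (Fin n → ℂ) → ℂ} (hg : ∀ z, g z ≠ 0)
    (hf : ∀ γ z, g z • C.factor γ z = g (z + period τ γ) • B.factor γ z) (γ : Period n)
    (z : Fin n → ℂ) : (g z)⁻¹ • B.factor γ z = (g (z + period τ γ))⁻¹ • C.factor γ z := by
  rw [inv_smul_eq_iff₀ (hg z), smul_comm, hf, inv_smul_smul₀ (hg _)]

namespace Iso

/-- The isomorphism given by a nowhere vanishing scalar function that intertwines the factors
and scalar connection forms of two bundles. -/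
noncomputable def ofScalar (g : (Fin n → ℂ) → ℂ) (hg : ∀ z, g z ≠ 0) (hs : ContDiff ℝ ∞ g)
    (hf : ∀ γ z, g z • C.factor γ z = g (z + period τ γ) • B.factor γ z)
    {b c : (Fin n → ℂ) → (Fin n → ℂ) → ℂ} (hb : ∀ z v, B.conn z v = b z v • 1)
    (hc : ∀ z v, C.conn z v = c z v • 1)
    (hd : ∀ z v, fderiv ℝ g z v + c z v * g z = g z * b z v) : Iso B C where
  toHomeomorph :=
    { toFun := scalarMap g hf
      invFun := scalarMap (fun z => (g z)⁻¹) (factor_gauge_symm hg hf)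
      left_inv := scalarMap_scalarMap (fun z => inv_mul_cancel₀ (hg z)) _ _
      right_inv := scalarMap_scalarMap (fun z => mul_inv_cancel₀ (hg z)) _ _
      continuous_toFun := continuous_scalarMap hs.continuous _
      continuous_invFun := continuous_scalarMap (hs.continuous.inv₀ hg) _ }
  proj_comp := by
    rintro ⟨z, v⟩
    rfl
  lift z := g z • 1
  lift_smooth i j := by
    simp only [Matrix.smul_apply, smul_eq_mul]
    exact hs.mul contDiff_const
  map_mk z v := by
    rw [Matrix.smul_mulVec, Matrix.one_mulVec]
    rfl
  parallel z v i j := by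
    have hg' : DifferentiableAt ℝ g z := (hs.differentiable (by simp)).differentiableAt
    simp only [hb, hc, smul_mul_smul_comm, mul_one, Matrix.smul_apply, smul_eq_mul, ← hd,
      fderiv_mul_const hg', _root_.smul_apply]
    ring

variable (F : Iso B C) {s : (Fin n → ℂ) → (Fin N → ℂ)} {z : Fin n → ℂ}

theorem lift_mulVec_eq_zero_iff {x : Fin N → ℂ} : F.lift z *ᵥ x = 0 ↔ x = 0 := by
  refine ⟨fun h => (B.pt_eq_zero_iff (z := z)).1 (F.toHomeomorph.injective ?_), ?_⟩
  · rw [F.map_mk, F.map_mk, h, Matrix.mulVec_zero]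
  · rintro rfl
    exact Matrix.mulVec_zero _

theorem differentiableAt_lift_mulVec (hs : DifferentiableAt ℝ s z) :
    DifferentiableAt ℝ (fun w => F.lift w *ᵥ s w) z :=
  (hasFDerivAt_mulVec (fun i j => ((F.lift_smooth i j).differentiable (by simp) z).hasFDerivAt)
    hs.hasFDerivAt).differentiableAt

theorem covDeriv_lift (hs : DifferentiableAt ℝ s z) (v : Fin n → ℂ) :
    C.covDeriv (fun w => F.lift w *ᵥ s w) z v = F.lift z *ᵥ B.covDeriv s z v := by
  let dF : Matrix (Fin N) (Fin N) ℂ := Matrix.of fun i j => fderiv ℝ (fun w => F.lift w i j) z v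
  have leibniz : fderiv ℝ (fun w => F.lift w *ᵥ s w) z v
      = F.lift z *ᵥ fderiv ℝ s z v + dF *ᵥ s z := by
    rw [(hasFDerivAt_mulVec (fun i j =>
      ((F.lift_smooth i j).differentiable (by simp) z).hasFDerivAt) hs.hasFDerivAt).fderiv]
    ext i
    simp [dF, Matrix.mulVec, dotProduct, Finset.sum_add_distrib, mul_comm (s z _)]
  have parallel : dF + C.conn z v * F.lift z = F.lift z * B.conn z v :=
    Matrix.ext fun i j => F.parallel z v i j
  rw [covDeriv, covDeriv, leibniz, Matrix.mulVec_mulVec, Matrix.mulVec_add, Matrix.mulVec_mulVec,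
    ← parallel, Matrix.add_mulVec]
  abel

theorem dbar_lift (hs : DifferentiableAt ℝ s z) (v : Fin n → ℂ) :
    C.dbar (fun w => F.lift w *ᵥ s w) z v = F.lift z *ᵥ B.dbar s z v := by
  rw [dbar, dbar, F.covDeriv_lift hs, F.covDeriv_lift hs, Matrix.mulVec_add, Matrix.mulVec_smul]

end Iso

theorem dbar_eq_zero_iff_of_conn_I_smul (hB : ∀ z v, B.conn z (I • v) = I • B.conn z v)
    {s : (Fin n → ℂ) → (Fin N → ℂ)} {z : Fin n → ℂ} (hs : DifferentiableAt ℝ s z) :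
    (∀ v, B.dbar s z v = 0) ↔ DifferentiableAt ℂ s z := by
  rw [differentiableAt_complex_iff_fderiv_smul_I hs]
  refine forall_congr' fun v => ?_
  rw [dbar, add_I_smul_eq_zero_iff, covDeriv, covDeriv, hB, Matrix.smul_mulVec, smul_add,
    add_left_inj]

theorem Iso.dbar_eq_zero_iff (F : Iso B C) (hC : ∀ z v, C.conn z (I • v) = I • C.conn z v)
    {s : (Fin n → ℂ) → (Fin N → ℂ)} {z : Fin n → ℂ} (hs : DifferentiableAt ℝ s z) :
    (∀ v, B.dbar s z v = 0) ↔ DifferentiableAt ℂ (fun w => F.lift w *ᵥ s w) z := by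
  simp only [← dbar_eq_zero_iff_of_conn_I_smul hC (F.differentiableAt_lift_mulVec hs),
    F.dbar_lift hs, F.lift_mulVec_eq_zero_iff]

end TorusBundle

section Connections

variable {n N : ℕ}

/-- The connection form of `ℰ_{(r,A,μ,𝒰)}`, divided by `i/2πr`. -/
noncomputable def flatForm (T : Matrix (Fin n) (Fin n) ℂ) (δ A : Matrix (Fin n) (Fin n) ℤ)
    (μ z v : Fin n → ℂ) : ℂ :=
  -(scaledR T A v z + (μ - star μ) ⬝ᵥ holY T δ *ᵥ v)

/-- The connection form of `φ^*E_{(r,A,μ,𝒰)}`, divided by `i/2πr`. -/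
noncomputable def pulledForm (T : Matrix (Fin n) (Fin n) ℂ) (δ A : Matrix (Fin n) (Fin n) ℤ)
    (μ z v : Fin n → ℂ) : ℂ :=
  -(coordPairing T δ A z v + μ ⬝ᵥ pulledY T δ v)

variable {T : Matrix (Fin n) (Fin n) ℂ} {δ A : Matrix (Fin n) (Fin n) ℤ}

theorem contDiff_psiExp (μ : Fin n → ℂ) : ContDiff ℝ ∞ (psiExp T δ A μ) := by
  have contDiff_diag : ∀ B : (Fin n → ℂ) →ₗ[ℝ] (Fin n → ℂ) →ₗ[ℝ] ℂ, ContDiff ℝ ∞ fun z => B z z :=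
    fun B => B.toContinuousBilinearMap.isBoundedBilinearMap.contDiff.comp
      (contDiff_id.prodMk contDiff_id)
  exact (psiLinear T δ μ).toContinuousLinearMap.contDiff.add
    (((contDiff_diag _).sub (contDiff_diag _)).div_const 2)

theorem flatBundle_conn [NeZero N] (r : ℕ) (μ : Fin n → ℂ) (ρ : AutFactor T r A N)
    (z v : Fin n → ℂ) :
    (flatBundle T δ r A μ ρ).conn z v
      = (I / (2 * Real.pi * r) * flatForm T δ A μ z v) • (1 : Matrix (Fin N) (Fin N) ℂ) := by
  have hN : (N : ℂ) ≠ 0 := NeZero.ne _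
  simp only [flatBundle, LinearMap.coe_mk, AddHom.coe_mk, formR_eq, flatForm, holY,
    sub_dotProduct]
  congr 1
  field_simp
  ring

theorem pulledBundle_conn (hT : (T.map Complex.im).det ≠ 0) (hδ : (T - toC δ).det ≠ 0) (r : ℕ)
    (μ : Fin n → ℂ) (𝒰 : SYZUnitaries r A N) (z v : Fin n → ℂ) :
    (pulledBundle T hT δ hδ r A μ 𝒰).conn z v
      = (I / (2 * Real.pi * r) * pulledForm T δ A μ z v) • (1 : Matrix (Fin N) (Fin N) ℂ) := by
  have h : pulledForm T δ A μ z v = -∑ i, (∑ j, (A i j : ℂ) *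
      coordX (primed T δ) (primed T δ *ᵥ z) j + μ i)
        * coordY (primed T δ) (primed T δ *ᵥ v) i := by
    rw [pulledForm, coordPairing_apply, ← add_dotProduct, ← (coord_phi hT hδ z).1,
      ← (coord_phi hT hδ v).2]
    rfl
  rw [h, mul_neg, ← neg_mul]
  rfl

theorem fderiv_psiExp (hT : (T.map Complex.im).det ≠ 0) (hs : (calA₀ T δ A).IsSymm)
    (μ z v : Fin n → ℂ) :
    fderiv ℝ (psiExp T δ A μ) z v = pulledForm T δ A μ z v - flatForm T δ A μ z v := by
  have hasFDerivAt_diag : ∀ B : (Fin n → ℂ) →ₗ[ℝ] (Fin n → ℂ) →ₗ[ℝ] ℂ,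
      HasFDerivAt (fun w => B w w) _ z := fun B =>
    B.toContinuousBilinearMap.hasFDerivAt_of_bilinear (hasFDerivAt_id z) (hasFDerivAt_id z)
  have h := (psiLinear T δ μ).toContinuousLinearMap.hasFDerivAt.add
    (((hasFDerivAt_diag (scaledR T A)).sub
      (hasFDerivAt_diag (coordPairing T δ A))).mul_const (2⁻¹ : ℂ))
  have h' : fderiv ℝ (psiExp T δ A μ) z v = psiLinear T δ μ v + (scaledR T A z v + scaledR T A v z
      - (coordPairing T δ A z v + coordPairing T δ A v z)) / 2 := by
    rw [div_eq_inv_mul]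
    exact congrArg (fun f => f v) h.fderiv
  rw [h', psiLinear_eq_sub_dotProduct_pulledY, pulledForm, flatForm]
  linear_combination (-1 / 2) * scaledR_sub_coordPairing_comm hT hs z v

theorem psi_ne_zero (r : ℕ) (μ z : Fin n → ℂ) : psi T δ r A μ N z ≠ 0 :=
  Complex.exp_ne_zero _

theorem contDiff_psi [NeZero N] (hT : (T.map Complex.im).det ≠ 0) (hs : (calA₀ T δ A).IsSymm)
    (r : ℕ) (μ : Fin n → ℂ) : ContDiff ℝ ∞ (psi T δ r A μ N) := by
  rw [funext (psi_eq_exp_psiExp hT hs r μ)]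
  exact (contDiff_const.mul (contDiff_psiExp μ)).cexp

theorem fderiv_psi_add_flatForm_mul [NeZero N] (hT : (T.map Complex.im).det ≠ 0)
    (hs : (calA₀ T δ A).IsSymm) (r : ℕ) (μ z v : Fin n → ℂ) :
    fderiv ℝ (psi T δ r A μ N) z v
        + I / (2 * Real.pi * r) * flatForm T δ A μ z v * psi T δ r A μ N z
      = psi T δ r A μ N z * (I / (2 * Real.pi * r) * pulledForm T δ A μ z v) := by
  have h := ((contDiff_psiExp (T := T) (δ := δ) (A := A) μ).differentiable (by simp) z).hasFDerivAt
  simp only [funext (psi_eq_exp_psiExp hT hs r μ), (h.const_mul _).cexp.fderiv,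
    _root_.smul_apply, smul_eq_mul, fderiv_psiExp hT hs]
  ring

theorem flatBundle_conn_I_smul [NeZero N] (r : ℕ) (μ : Fin n → ℂ) (ρ : AutFactor T r A N)
    (z v : Fin n → ℂ) : (flatBundle T δ r A μ ρ).conn z (I • v)
      = I • (flatBundle T δ r A μ ρ).conn z v := by
  simp only [flatBundle_conn, flatForm, (scaledR_I_smul _ _ _ _).1, Matrix.mulVec_smul,
    dotProduct_smul, smul_smul, smul_eq_mul]
  congr 1
  ring

theorem flatBundle_isProjectivelyFlat [NeZero N] (r : ℕ) (μ : Fin n → ℂ) (ρ : AutFactor T r A N) :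
    (flatBundle T δ r A μ ρ).IsProjectivelyFlat :=
  ⟨_, TorusBundle.curvature_of_scalar (flatBundle_conn r μ ρ)⟩

theorem hasFDerivAt_pulledForm (μ z v : Fin n → ℂ) :
    HasFDerivAt (fun w => pulledForm T δ A μ w v)
      (-((coordPairing T δ A).flip v).toContinuousLinearMap) z :=
  (((coordPairing T δ A).flip v).toContinuousLinearMap.hasFDerivAt.add_const
    (μ ⬝ᵥ pulledY T δ v)).neg

theorem curvature_pulledBundle (hT : (T.map Complex.im).det ≠ 0) (hδ : (T - toC δ).det ≠ 0)
    (hs : (calA₀ T δ A).IsSymm) (r : ℕ) (μ : Fin n → ℂ) (𝒰 : SYZUnitaries r A N)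
    (z u v : Fin n → ℂ) :
    (pulledBundle T hT δ hδ r A μ 𝒰).curvature z u v
      = (I / (2 * Real.pi * r) * (scaledR T A u v - scaledR T A v u)) • 1 := by
  rw [TorusBundle.curvature_of_scalar (pulledBundle_conn hT hδ r μ 𝒰)]
  simp only [((hasFDerivAt_pulledForm μ z _).const_mul _).fderiv, _root_.smul_apply,
    _root_.neg_apply, LinearMap.coe_toContinuousLinearMap', LinearMap.flip_apply, smul_eq_mul]
  congr 1
  linear_combination I / (2 * Real.pi * r) * scaledR_sub_coordPairing_comm hT hs u v

theorem pulledBundle_isHolomorphic (hT : (T.map Complex.im).det ≠ 0) (hδ : (T - toC δ).det ≠ 0)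
    (hs : (calA₀ T δ A).IsSymm) (r : ℕ) (μ : Fin n → ℂ) (𝒰 : SYZUnitaries r A N) :
    (pulledBundle T hT δ hδ r A μ 𝒰).IsHolomorphic := by
  intro z u v
  simp only [curvature_pulledBundle hT hδ hs, scaledR_I_smul, smul_smul, ← add_smul, ← sub_smul]
  convert zero_smul ℂ _
  linear_combination I / (2 * Real.pi * r) * (scaledR T A u v - scaledR T A v u) * I_sq

end Connections

section Factor

variable {n N : ℕ} {T : Matrix (Fin n) (Fin n) ℂ} {δ A : Matrix (Fin n) (Fin n) ℤ}

/-- The exponent, divided by `i/2πr`, of the scalar by which `U(γ)` differs from the unitary part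
of the transition function of `φ^*E_{(r,A,μ,𝒰)}`, where `g` is the lattice vector `γ`. -/
noncomputable def gaugeAngle (T : Matrix (Fin n) (Fin n) ℂ) (δ A : Matrix (Fin n) (Fin n) ℤ)
    (μ g : Fin n → ℂ) : ℂ :=
  psiLinear T δ μ g + coordPairing T δ A g g / 2

theorem conj_gaugeAngle (hT : (T.map Complex.im).det ≠ 0) (μ g : Fin n → ℂ) :
    conj (gaugeAngle T δ A μ g) = gaugeAngle T δ A μ g := by
  rw [gaugeAngle, map_add, map_div₀, map_ofNat, conj_psiLinear hT, conj_coordPairing hT]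

theorem psiExp_add_gaugeAngle (hT : (T.map Complex.im).det ≠ 0) (hs : (calA₀ T δ A).IsSymm)
    (μ z g : Fin n → ℂ) :
    psiExp T δ A μ z + scaledR T A z g + scaledR T A g g / 2 + gaugeAngle T δ A μ g
      = psiExp T δ A μ (z + g) + coordPairing T δ A g (z + g) := by
  rw [psiExp_add hT hs, scaledR_sub_coordPairing_comm hT hs, gaugeAngle, map_add]
  simp only [psiExp]
  ring

theorem pulledBundle_factor (hT : (T.map Complex.im).det ≠ 0) (hδ : (T - toC δ).det ≠ 0) (r : ℕ)
    (μ : Fin n → ℂ) (𝒰 : SYZUnitaries r A N) (γ : Period n) (z : Fin n → ℂ) :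
    (pulledBundle T hT δ hδ r A μ 𝒰).factor γ z
      = Complex.exp (I / (2 * Real.pi * r)
          * coordPairing T δ A (period T γ) (z + period T γ)) •
        ((powProd 𝒰.V (-γ.2) * powProd 𝒰.U (γ.1 + δ *ᵥ γ.2) : Matrix.unitaryGroup (Fin N) ℂ) :
          Matrix (Fin N) (Fin N) ℂ) := by
  have coord_phi_period := coord_period (primed_im_det_ne_zero hT hδ) ((phi T δ hδ).per γ)
  rw [← (phi T δ hδ).lin_period γ] at coord_phi_period
  change coordX _ (primed T δ *ᵥ _) = _ ∧ coordY _ (primed T δ *ᵥ _) = _ at coord_phi_period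
  have hexp : I / (2 * Real.pi * r) * coordPairing T δ A (period T γ) (z + period T γ)
      = I / r * ∑ j, ∑ i, (((-γ.2) j : ℤ) : ℂ) * A i j *
        (coordY (primed T δ) (primed T δ *ᵥ z) i + 2 * Real.pi * ((γ.1 + δ *ᵥ γ.2) i : ℤ)) := by
    have hpi : (Real.pi : ℂ) ≠ 0 := by exact_mod_cast Real.pi_ne_zero
    rw [coordPairing_apply, ← (coord_phi hT hδ _).1, ← (coord_phi hT hδ _).2, Matrix.mulVec_add,
      map_add, coord_phi_period.1, coord_phi_period.2, Finset.sum_comm]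
    simp only [dotProduct, Matrix.mulVec, Finset.mul_sum, Finset.sum_mul]
    refine Finset.sum_congr rfl fun i _ => Finset.sum_congr rfl fun j _ => ?_
    simp only [phi, toC, Matrix.map_apply, Pi.add_apply, Complex.ofReal_add, Complex.ofReal_mul,
      Complex.ofReal_ofNat, Complex.ofReal_intCast, Equiv.coe_fn_mk, AddEquiv.coe_mk,
      Matrix.mulVec, dotProduct]
    field_simp
  rw [hexp]
  rfl

/-- The argument of the scalar by which `U(γ)` differs from the unitary part of the transition
function of `φ^*E_{(r,A,μ,𝒰)}`. -/
noncomputable def gaugePhase (T : Matrix (Fin n) (Fin n) ℂ) (δ : Matrix (Fin n) (Fin n) ℤ) (r : ℕ)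
    (A : Matrix (Fin n) (Fin n) ℤ) (μ : Fin n → ℂ) (γ : Period n) : ℝ :=
  (gaugeAngle T δ A μ (period T γ)).re / (2 * Real.pi * r)

/-- The unitary part `U(γ)` of the factor of automorphy that `Ψ` makes out of the transition
functions of `φ^*E_{(r,A,μ,𝒰)}`. -/
noncomputable def gaugedUnitary (T : Matrix (Fin n) (Fin n) ℂ) (δ : Matrix (Fin n) (Fin n) ℤ)
    {r : ℕ} (μ : Fin n → ℂ) (𝒰 : SYZUnitaries r A N) (γ : Period n) :
    Matrix.unitaryGroup (Fin N) ℂ :=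
  phase N (gaugePhase T δ r A μ γ) * (powProd 𝒰.V (-γ.2) * powProd 𝒰.U (γ.1 + δ *ᵥ γ.2))

variable [NeZero N]

theorem psi_smul_autJ_gaugedUnitary (hT : (T.map Complex.im).det ≠ 0) (hδ : (T - toC δ).det ≠ 0)
    (hs : (calA₀ T δ A).IsSymm) {r : ℕ} (μ : Fin n → ℂ) (𝒰 : SYZUnitaries r A N) (γ : Period n)
    (z : Fin n → ℂ) :
    psi T δ r A μ N z • autJ T r A (gaugedUnitary T δ μ 𝒰) γ z
      = psi T δ r A μ N (z + period T γ) • (pulledBundle T hT δ hδ r A μ 𝒰).factor γ z := by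
  have hN : (N : ℂ) ≠ 0 := NeZero.ne _
  have hphase : (gaugePhase T δ r A μ γ : ℂ) * I
      = I / (2 * Real.pi * r) * gaugeAngle T δ A μ (period T γ) := by
    have hreal := Complex.conj_eq_iff_re.1 (conj_gaugeAngle (δ := δ) (A := A) hT μ (period T γ))
    rw [gaugePhase]
    push_cast
    rw [hreal]
    ring
  rw [pulledBundle_factor hT hδ, autJ, gaugedUnitary, Submonoid.coe_mul, phase_coe, smul_mul_assoc,
    one_mul, smul_smul, smul_smul, smul_smul, psi_eq_exp_psiExp hT hs, psi_eq_exp_psiExp hT hs,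
    ← Complex.exp_add, ← Complex.exp_add, ← Complex.exp_add, ← mul_add,
    ← psiExp_add_gaugeAngle hT hs, hphase, formR_eq, formR_eq]
  congr 2
  field_simp
  ring

/-- The factor of automorphy obtained from the transition functions of `φ^*E_{(r,A,μ,𝒰)}` by the
gauge transformation `Ψ`. -/
noncomputable def gaugedFactor (hT : (T.map Complex.im).det ≠ 0) (hδ : (T - toC δ).det ≠ 0)
    (hs : (calA₀ T δ A).IsSymm) {r : ℕ} (μ : Fin n → ℂ) (𝒰 : SYZUnitaries r A N) :
    AutFactor T r A N where
  U := gaugedUnitary T δ μ 𝒰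
  cocycle γ γ' z := by
    have autJ_eq : ∀ γ z, autJ T r A (gaugedUnitary T δ μ 𝒰) γ z
        = (psi T δ r A μ N z)⁻¹ • psi T δ r A μ N (z + period T γ) •
          (pulledBundle T hT δ hδ r A μ 𝒰).factor γ z := fun γ z => by
      rw [← psi_smul_autJ_gaugedUnitary hT hδ hs, inv_smul_smul₀ (psi_ne_zero r μ z)]
    rw [autJ_eq, autJ_eq, autJ_eq, TorusBundle.factor_add, smul_mul_smul_comm, smul_mul_smul_comm,
      smul_smul, smul_smul, map_add, add_comm (period T γ), add_assoc]
    congr 1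
    have hz := psi_ne_zero (T := T) (δ := δ) (A := A) (N := N) r μ z
    have hz' := psi_ne_zero (T := T) (δ := δ) (A := A) (N := N) r μ (z + period T γ')
    field_simp

/-- `Ψ` as an isomorphism of bundles with connection. -/
noncomputable def psiIso (hT : (T.map Complex.im).det ≠ 0) (hδ : (T - toC δ).det ≠ 0)
    (hs : (calA₀ T δ A).IsSymm) {r : ℕ} (μ : Fin n → ℂ) (𝒰 : SYZUnitaries r A N) :
    TorusBundle.Iso (pulledBundle T hT δ hδ r A μ 𝒰)
      (flatBundle T δ r A μ (gaugedFactor hT hδ hs μ 𝒰)) :=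
  .ofScalar (psi T δ r A μ N) (psi_ne_zero r μ) (contDiff_psi hT hs r μ)
    (psi_smul_autJ_gaugedUnitary hT hδ hs μ 𝒰) (pulledBundle_conn hT hδ r μ 𝒰)
    (flatBundle_conn r μ _) (fderiv_psi_add_flatForm_mul hT hs r μ)

end Factor

section Automorphy

variable {n N : ℕ} {T : Matrix (Fin n) (Fin n) ℂ} {r : ℕ} {A : Matrix (Fin n) (Fin n) ℤ}

theorem isUnit_autJ (U : Period n → Matrix.unitaryGroup (Fin N) ℂ) (γ : Period n)
    (z : Fin n → ℂ) : IsUnit (autJ T r A U γ z) :=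
  (Unitary.toUnits (U γ)).isUnit.smul (Units.mk0 _ (Complex.exp_ne_zero _))

theorem autJ_eq_autJ_iff {U U' : Period n → Matrix.unitaryGroup (Fin N) ℂ} {γ : Period n}
    {z : Fin n → ℂ} : autJ T r A U γ z = autJ T r A U' γ z ↔ U γ = U' γ := by
  rw [autJ, autJ, smul_right_inj (Complex.exp_ne_zero _), Subtype.ext_iff]

theorem AutFactor.autJ_zero (ρ : AutFactor T r A N) (z : Fin n → ℂ) : autJ T r A ρ.U 0 z = 1 := by
  have h := ρ.cocycle 0 0 z
  rw [add_zero, map_zero, add_zero] at h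
  exact (isUnit_autJ ρ.U 0 z).mul_eq_left.1 h.symm

/-- The lattice vectors at which two factors of automorphy agree. -/
def AutFactor.eqLocus (ρ ρ' : AutFactor T r A N) : AddSubgroup (Period n) where
  carrier := {γ | ρ.U γ = ρ'.U γ}
  zero_mem' := (autJ_eq_autJ_iff (T := T) (r := r) (A := A) (z := 0)).1 <| by
    rw [ρ.autJ_zero, ρ'.autJ_zero]
  add_mem' {γ γ'} h h' := (autJ_eq_autJ_iff (T := T) (r := r) (A := A) (z := 0)).1 <| by
    rw [ρ.cocycle, ρ'.cocycle, autJ_eq_autJ_iff.2 h, autJ_eq_autJ_iff.2 h']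
  neg_mem' {γ} h := (autJ_eq_autJ_iff (T := T) (r := r) (A := A) (z := 0 + period T γ)).1 <|
    (isUnit_autJ ρ.U γ 0).mul_right_cancel <| by
      rw [← ρ.cocycle, neg_add_cancel, ρ.autJ_zero, autJ_eq_autJ_iff.2 h, ← ρ'.cocycle,
        neg_add_cancel, ρ'.autJ_zero]

theorem period_eq_sum_generators (γ : Period n) :
    γ = ∑ j, γ.1 j • ((Pi.single j 1, 0) : Period n)
      + ∑ k, γ.2 k • ((0, Pi.single k 1) : Period n) := by
  ext i <;> simp [Prod.fst_sum, Prod.snd_sum, Finset.sum_apply, Pi.single_apply]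

theorem AutFactor.Extends.unique {δ : Matrix (Fin n) (Fin n) ℤ} {𝒲 : AutUnitaries δ r A N}
    {ρ ρ' : AutFactor T r A N} (h : ρ.Extends 𝒲) (h' : ρ'.Extends 𝒲) : ρ = ρ' := by
  refine AutFactor.ext (funext fun γ => ?_)
  change γ ∈ ρ.eqLocus ρ'
  rw [period_eq_sum_generators γ]
  refine add_mem (sum_mem fun j _ => zsmul_mem ?_ _) (sum_mem fun k _ => zsmul_mem ?_ _)
  · exact (h.1 j).trans (h'.1 j).symm
  · exact (h.2 k).trans (h'.2 k).symm

end Automorphy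

section TwistedFamilies

variable {G : Type*} [Group G] {n : ℕ}

theorem powProd_succ (g : Fin (n + 1) → G) (a : Fin (n + 1) → ℤ) :
    powProd g a = g 0 ^ a 0 * powProd (fun j => g j.succ) (fun j => a j.succ) := by
  rw [powProd, List.ofFn_succ, List.prod_cons, powProd]

theorem powProd_neg (g : Fin n → G) (h : ∀ i j, Commute (g i) (g j)) (a : Fin n → ℤ) :
    powProd g (-a) = (powProd g a)⁻¹ := by
  rw [eq_inv_iff_mul_eq_one, ← powProd_add g h, neg_add_cancel, powProd_zero]

/-- The commutation relation `x y = q ^ m y x`, used for central `q`. -/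
def CommuteUpTo (q : G) (m : ℤ) (x y : G) : Prop := SemiconjBy x y (q ^ m * y)

namespace CommuteUpTo

variable {q x y z : G} {l m : ℤ}

theorem zero_iff : CommuteUpTo q 0 x y ↔ Commute x y := by
  rw [CommuteUpTo, zpow_zero, one_mul, Commute]

theorem of_commute (h : Commute x y) : CommuteUpTo q 0 x y :=
  zero_iff.2 h

theorem symm (h : CommuteUpTo q m x y) : CommuteUpTo q (-m) y x := by
  rw [CommuteUpTo, SemiconjBy, _root_.zpow_neg, mul_assoc, eq_inv_mul_iff_mul_eq, ← mul_assoc]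
  exact h.eq.symm

variable (hq : ∀ y, Commute q y)
include hq

theorem mul_right (hy : CommuteUpTo q l x y) (hz : CommuteUpTo q m x z) :
    CommuteUpTo q (l + m) x (y * z) := by
  have h := SemiconjBy.mul_right hy hz
  rwa [((hq y).symm.zpow_right m).mul_mul_mul_comm, ← _root_.zpow_add] at h

theorem mul_left (hx : CommuteUpTo q l x z) (hy : CommuteUpTo q m y z) :
    CommuteUpTo q (l + m) (x * y) z := by
  simpa [add_comm] using (hx.symm.mul_right hq hy.symm).symm

theorem inv_left (h : CommuteUpTo q m x y) : CommuteUpTo q (-m) x⁻¹ y := by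
  have h' := SemiconjBy.inv_symm_left h
  rw [SemiconjBy, ← ((hq x⁻¹).zpow_left m).left_comm] at h'
  rwa [CommuteUpTo, SemiconjBy, _root_.zpow_neg, mul_assoc, eq_inv_mul_iff_mul_eq]

theorem zpow_right (h : CommuteUpTo q m x y) (a : ℤ) : CommuteUpTo q (a * m) x (y ^ a) := by
  have h' := SemiconjBy.zpow_right h a
  rwa [((hq y).zpow_left m).mul_zpow, ← _root_.zpow_mul, mul_comm m] at h'

theorem powProd_right {g : Fin n → G} {m : Fin n → ℤ} (h : ∀ j, CommuteUpTo q (m j) x (g j))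
    (a : Fin n → ℤ) : CommuteUpTo q (a ⬝ᵥ m) x (powProd g a) := by
  induction n with
  | zero => exact .of_commute (Commute.one_right x)
  | succ n ih =>
    rw [powProd_succ, dotProduct, Fin.sum_univ_succ]
    exact ((h 0).zpow_right hq _).mul_right hq (ih (fun j => h j.succ) _)

end CommuteUpTo

theorem commute_powProd {x : G} {g : Fin n → G} (h : ∀ j, Commute x (g j)) (a : Fin n → ℤ) :
    Commute x (powProd g a) := by
  refine Commute.list_prod_right _ _ fun y hy => ?_
  obtain ⟨j, rfl⟩ := (List.mem_ofFn' _ _).1 hy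
  exact (h j).zpow_right _

/-- Elements `X_k` and commuting elements `W_j` of a group with `X_k W_j = q ^ a_{jk} W_j X_k` and
`X_j X_k = q ^ c_{jk} X_k X_j`. Both kinds of families of unitary matrices in the theorem are of
this form, with the same `A` and with different `C`. -/
@[ext]
structure TwistedFamily (q : G) (A C : Matrix (Fin n) (Fin n) ℤ) where
  X : Fin n → G
  W : Fin n → G
  W_W : ∀ j k, Commute (W j) (W k)
  X_W : ∀ j k, CommuteUpTo q (A j k) (X k) (W j)
  X_X : ∀ j k, CommuteUpTo q (C j k) (X j) (X k)

namespace TwistedFamily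

variable {q : G} {A C C' : Matrix (Fin n) (Fin n) ℤ}

/-- The family `X_k ∏ₗ W_l ^ ε_{lk}`, `W_j`. -/
def twist (hq : ∀ y, Commute q y) (ε : Matrix (Fin n) (Fin n) ℤ)
    (hC : C' = C + (Aᵀ * ε - (Aᵀ * ε)ᵀ)) (F : TwistedFamily q A C) : TwistedFamily q A C' where
  X k := F.X k * powProd F.W (ε.col k)
  W := F.W
  W_W := F.W_W
  X_W j k := by
    simpa using (F.X_W j k).mul_left hq
      (.of_commute (commute_powProd (F.W_W j) (ε.col k)).symm)
  X_X j k := by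
    have hXP : ∀ j k, CommuteUpTo q ((Aᵀ * ε) j k) (F.X j) (powProd F.W (ε.col k)) := fun j k => by
      have h := CommuteUpTo.powProd_right hq (fun l => F.X_W l j) (ε.col k)
      rwa [dotProduct_comm] at h
    have hPP : Commute (powProd F.W (ε.col j)) (powProd F.W (ε.col k)) :=
      commute_powProd (fun l => (commute_powProd (F.W_W l) _).symm) _
    have h := ((F.X_X j k).mul_right hq (hXP j k)).mul_left hq
      ((hXP k j).symm.mul_right hq (.of_commute hPP))
    convert h using 1
    rw [hC, Matrix.add_apply, Matrix.sub_apply, Matrix.transpose_apply (Aᵀ * ε)]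
    ring

/-- The inverse of twisting by `ε` is twisting by `-ε`. -/
def twistEquiv (hq : ∀ y, Commute q y) (ε : Matrix (Fin n) (Fin n) ℤ)
    (hC : C' = C + (Aᵀ * ε - (Aᵀ * ε)ᵀ)) : TwistedFamily q A C ≃ TwistedFamily q A C' where
  toFun := twist hq ε hC
  invFun := twist hq (-ε) (by rw [hC, Matrix.mul_neg, Matrix.transpose_neg]; abel)
  left_inv F := TwistedFamily.ext (funext fun k => by
    change F.X k * powProd F.W (ε.col k) * powProd F.W (-ε.col k) = _
    rw [powProd_neg _ F.W_W, mul_inv_cancel_right]) rfl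
  right_inv F := TwistedFamily.ext (funext fun k => by
    change F.X k * powProd F.W (-ε.col k) * powProd F.W (ε.col k) = _
    rw [powProd_neg _ F.W_W, inv_mul_cancel_right]) rfl

/-- The family `d_k X_k`, `c_j W_j`. -/
def scale (hq : ∀ y, Commute q y) {c d : Fin n → G} (hc : ∀ j y, Commute (c j) y)
    (hd : ∀ k y, Commute (d k) y) (F : TwistedFamily q A C) : TwistedFamily q A C where
  X k := d k * F.X k
  W j := c j * F.W j
  W_W j k := (hc j _).mul_left ((hc k _).symm.mul_right (F.W_W j k))
  X_W j k := by
    simpa using (CommuteUpTo.of_commute (hd k _)).mul_left hq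
      ((CommuteUpTo.of_commute (hc j _).symm).mul_right hq (F.X_W j k))
  X_X j k := by
    simpa using (CommuteUpTo.of_commute (hd j _)).mul_left hq
      ((CommuteUpTo.of_commute (hd k _).symm).mul_right hq (F.X_X j k))

/-- Scaling by central elements, as a permutation of the families. -/
def scaleEquiv (hq : ∀ y, Commute q y) {c d : Fin n → G} (hc : ∀ j y, Commute (c j) y)
    (hd : ∀ k y, Commute (d k) y) : TwistedFamily q A C ≃ TwistedFamily q A C where
  toFun := scale hq hc hd
  invFun := scale hq (fun j y => (hc j y).inv_left) (fun k y => (hd k y).inv_left)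
  left_inv _ := TwistedFamily.ext (funext fun _ => inv_mul_cancel_left _ _)
    (funext fun _ => inv_mul_cancel_left _ _)
  right_inv _ := TwistedFamily.ext (funext fun _ => mul_inv_cancel_left _ _)
    (funext fun _ => mul_inv_cancel_left _ _)

end TwistedFamily

end TwistedFamilies

section Correspondence

variable {n N r : ℕ} {A : Matrix (Fin n) (Fin n) ℤ}

theorem commuteUpTo_phase_iff {m : ℤ} {x y : Matrix.unitaryGroup (Fin N) ℂ} :
    CommuteUpTo (phase N (2 * Real.pi / r)) m x y ↔
      (x : Matrix (Fin N) (Fin N) ℂ) * (y : Matrix (Fin N) (Fin N) ℂ)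
        = zetaRoot r ^ m • ((y : Matrix (Fin N) (Fin N) ℂ) * (x : Matrix (Fin N) (Fin N) ℂ)) := by
  have hzeta : zetaRoot r ^ m = Complex.exp ((m * (2 * Real.pi / r) : ℝ) * I) := by
    rw [zetaRoot, ← Complex.exp_int_mul]
    push_cast
    ring_nf
  rw [CommuteUpTo, SemiconjBy, Subtype.ext_iff, phase_zpow, Submonoid.coe_mul, Submonoid.coe_mul,
    Submonoid.coe_mul, phase_coe, ← hzeta, smul_mul_assoc, one_mul, smul_mul_assoc]

/-- A family of unitary matrices `V_j`, `U_k` as the twisted family `V_k⁻¹`, `U_j`. -/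
def syzEquivTwistedFamily :
    SYZUnitaries r A N ≃ TwistedFamily (phase N (2 * Real.pi / r)) A 0 where
  toFun 𝒰 :=
    { X := fun k => (𝒰.V k)⁻¹
      W := 𝒰.U
      W_W := 𝒰.U_comm
      X_W := fun j k => by
        have h := commuteUpTo_phase_iff.2 (𝒰.U_V k j).symm
        simpa using h.inv_left (phase_commute _)
      X_X := fun j k => .of_commute (Commute.inv_inv (𝒰.V_comm j k)) }
  invFun F :=
    { V := fun j => (F.X j)⁻¹
      U := F.W
      V_comm := fun j k => (CommuteUpTo.zero_iff.1 (F.X_X j k)).inv_inv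
      U_comm := F.W_W
      U_V := fun j k =>
        (commuteUpTo_phase_iff.1 ((F.X_W k j).inv_left (phase_commute _))).symm }
  left_inv _ := SYZUnitaries.ext (funext fun _ => inv_inv _) rfl
  right_inv _ := TwistedFamily.ext (funext fun _ => inv_inv _) rfl

/-- A family of unitary matrices `U(γ_j)`, `U(γ'_k)` as the twisted family `U(γ'_k)`, `U(γ_j)`. -/
def autEquivTwistedFamily (δ : Matrix (Fin n) (Fin n) ℤ) :
    AutUnitaries δ r A N ≃
      TwistedFamily (phase N (2 * Real.pi / r)) A (Aᵀ * δ - (Aᵀ * δ)ᵀ) where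
  toFun 𝒲 :=
    { X := 𝒲.W'
      W := 𝒲.W
      W_W := 𝒲.W_comm
      X_W := fun j k => by
        have h := commuteUpTo_phase_iff.2 (𝒲.W'_W j k).symm
        simpa using h.symm
      X_X := fun j k => commuteUpTo_phase_iff.2 (𝒲.W'_comm j k) }
  invFun F :=
    { W := F.W
      W' := F.X
      W_comm := F.W_W
      W'_comm := fun j k => commuteUpTo_phase_iff.1 (F.X_X j k)
      W'_W := fun j k => (commuteUpTo_phase_iff.1 (F.X_W j k).symm).symm }

/-- The correspondence `U(γ_j) = e^{i s_j} U_j`, `U(γ'_k) = e^{i t_k} V_k⁻¹ ∏ₗ U_l ^ δ_{lk}`. -/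
noncomputable def unitariesEquiv (δ : Matrix (Fin n) (Fin n) ℤ) (s t : Fin n → ℝ) :
    SYZUnitaries r A N ≃ AutUnitaries δ r A N :=
  syzEquivTwistedFamily.trans <|
    (TwistedFamily.twistEquiv (phase_commute _) δ (zero_add _).symm).trans <|
    (TwistedFamily.scaleEquiv (phase_commute _) (fun j => phase_commute (s j))
      (fun k => phase_commute (t k))).trans (autEquivTwistedFamily δ).symm

end Correspondence

theorem gaugedFactor_extends {n N r : ℕ} [NeZero N] {T : Matrix (Fin n) (Fin n) ℂ}
    {δ A : Matrix (Fin n) (Fin n) ℤ} (hT : (T.map Complex.im).det ≠ 0)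
    (hδ : (T - toC δ).det ≠ 0) (hs : (calA₀ T δ A).IsSymm) (μ : Fin n → ℂ)
    (𝒰 : SYZUnitaries r A N) :
    (gaugedFactor hT hδ hs μ 𝒰).Extends
      (unitariesEquiv δ (fun j => gaugePhase T δ r A μ (Pi.single j 1, 0))
        (fun k => gaugePhase T δ r A μ (0, Pi.single k 1)) 𝒰) := by
  constructor
  · intro j
    change phase N _ * (powProd 𝒰.V (-0) * powProd 𝒰.U (Pi.single j 1 + δ *ᵥ 0)) = phase N _ * 𝒰.U j
    rw [neg_zero, powProd_zero, one_mul, Matrix.mulVec_zero, add_zero, powProd_single]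
  · intro k
    change phase N _ * (powProd 𝒰.V (-Pi.single k 1) * powProd 𝒰.U (0 + δ *ᵥ Pi.single k 1))
      = phase N _ * ((𝒰.V k)⁻¹ * powProd 𝒰.U (δ.col k))
    rw [powProd_neg _ 𝒰.V_comm, powProd_single, zero_add, Matrix.mulVec_single_one]

theorem pulledBundle_dbar_eq_zero_iff_differentiableOn {n N : ℕ} [NeZero N]
    {T : Matrix (Fin n) (Fin n) ℂ} {δ A : Matrix (Fin n) (Fin n) ℤ}
    (hT : (T.map Complex.im).det ≠ 0) (hδ : (T - toC δ).det ≠ 0) (hs : (calA₀ T δ A).IsSymm)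
    {r : ℕ} (μ : Fin n → ℂ) (𝒰 : SYZUnitaries r A N) {Ω : Set (Fin n → ℂ)}
    {s : (Fin n → ℂ) → (Fin N → ℂ)} (hΩ : IsOpen Ω) (hsΩ : DifferentiableOn ℝ s Ω) :
    (∀ z ∈ Ω, ∀ v, (pulledBundle T hT δ hδ r A μ 𝒰).dbar s z v = 0) ↔
      DifferentiableOn ℂ (fun z => psi T δ r A μ N z • s z) Ω := by
  refine forall₂_congr fun z hz => ?_
  have hlift : (fun w => (psiIso hT hδ hs μ 𝒰).lift w *ᵥ s w)
      = fun w => psi T δ r A μ N w • s w := funext fun w => by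
    change (psi T δ r A μ N w • (1 : Matrix (Fin N) (Fin N) ℂ)) *ᵥ s w = _
    rw [Matrix.smul_mulVec, Matrix.one_mulVec]
  rw [(psiIso hT hδ hs μ 𝒰).dbar_eq_zero_iff (flatBundle_conn_I_smul r μ _ ·)
    (hsΩ.differentiableAt (hΩ.mem_nhds hz)), hlift]
  exact ⟨fun h => h.differentiableWithinAt, fun h => h.differentiableAt (hΩ.mem_nhds hz)⟩

theorem SmithForm.rank_ne_zero {n : ℕ} {A : Matrix (Fin n) (Fin n) ℤ} (S : SmithForm A) {r : ℕ}
    (hr : 0 < r) : S.rank r ≠ 0 :=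
  Finset.prod_ne_zero_iff.2 fun _ _ =>
    (Nat.div_pos (Nat.gcd_le_left _ hr) (Nat.gcd_pos_of_pos_left _ hr)).ne'

theorem theorem5p1_general {n : ℕ} (T : Matrix (Fin n) (Fin n) ℂ)
    (hT : (T.map Complex.im).det ≠ 0)
    (δ : Matrix (Fin n) (Fin n) ℤ) (hδ : (T - toC δ).det ≠ 0)
    (r : ℕ) (hr : 0 < r) (A : Matrix (Fin n) (Fin n) ℤ) (N : ℕ) [NeZero N]
    (hA : (toC A * primed T δ).IsSymm) (μ : Fin n → ℂ) :
    (∀ 𝒲 : AutUnitaries δ r A N, ∃! ρ : AutFactor T r A N, ρ.Extends 𝒲) ∧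
    ∃ Θ : SYZUnitaries r A N ≃ AutUnitaries δ r A N,
      ∀ (𝒰 : SYZUnitaries r A N) (ρ : AutFactor T r A N), ρ.Extends (Θ 𝒰) →
        (flatBundle T δ r A μ ρ).IsProjectivelyFlat ∧
        (pulledBundle T hT δ hδ r A μ 𝒰).IsHolomorphic ∧
        (∃ F : TorusBundle.Iso (pulledBundle T hT δ hδ r A μ 𝒰) (flatBundle T δ r A μ ρ),
          ∀ z, F.lift z = psi T δ r A μ N z • 1) ∧
        ∀ (Ω : Set (Fin n → ℂ)) (s : (Fin n → ℂ) → (Fin N → ℂ)), IsOpen Ω →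
          ContDiffOn ℝ ∞ s Ω →
          ((∀ z ∈ Ω, ∀ v, (pulledBundle T hT δ hδ r A μ 𝒰).dbar s z v = 0) ↔
            DifferentiableOn ℂ (fun z => psi T δ r A μ N z • s z) Ω) := by
  have hs := calA₀_isSymm hδ hA
  have hext := gaugedFactor_extends (N := N) (r := r) hT hδ hs μ
  set Θ := unitariesEquiv (r := r) (A := A) (N := N) δ _ _
  refine ⟨fun 𝒲 => ?_, Θ, fun 𝒰 ρ hρ => ?_⟩
  · obtain ⟨𝒰, rfl⟩ := Θ.surjective 𝒲
    exact ⟨_, hext 𝒰, fun ρ hρ => hρ.unique (hext 𝒰)⟩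
  · obtain rfl : ρ = gaugedFactor hT hδ hs μ 𝒰 := hρ.unique (hext 𝒰)
    exact ⟨flatBundle_isProjectivelyFlat r μ _, pulledBundle_isHolomorphic hT hδ hs r μ 𝒰,
      ⟨psiIso hT hδ hs μ 𝒰, fun _ => rfl⟩, fun _ _ hΩ hsΩ =>
        pulledBundle_dbar_eq_zero_iff_differentiableOn hT hδ hs μ 𝒰 hΩ
          (hsΩ.differentiableOn (by simp))⟩

theorem theorem5p1 {n : ℕ} (T : Matrix (Fin n) (Fin n) ℂ) (hdet : T.det = 0)
    (hT : ∀ x : Fin n → ℝ, x ≠ 0 → 0 < x ⬝ᵥ T.map Complex.im *ᵥ x)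
    (δ : Matrix (Fin n) (Fin n) ℤ) (hδ : (T - toC δ).det ≠ 0)
    (r : ℕ) (hr : 0 < r) (A : Matrix (Fin n) (Fin n) ℤ) (S : SmithForm A)
    (hA : (toC A * primed T δ)ᵀ = toC A * primed T δ) (μ : Fin n → ℂ) :
    -- each family of matrices `U(γ_j)`, `U(γ'_k)` comes from exactly one factor of automorphy `j`
    (∀ 𝒲 : AutUnitaries δ r A (S.rank r),
      ∃! ρ : AutFactor T r A (S.rank r), ρ.Extends 𝒲) ∧
    -- the families `𝒰` for the two kinds of bundles correspond to each other bijectively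
    ∃ Θ : SYZUnitaries r A (S.rank r) ≃ AutUnitaries δ r A (S.rank r),
      ∀ (𝒰 : SYZUnitaries r A (S.rank r)) (ρ : AutFactor T r A (S.rank r)), ρ.Extends (Θ 𝒰) →
        (flatBundle T δ r A μ ρ).IsProjectivelyFlat ∧
        (pulledBundle T (im_det_ne_zero hT) δ hδ r A μ 𝒰).IsHolomorphic ∧
        (∃ F : TorusBundle.Iso (pulledBundle T (im_det_ne_zero hT) δ hδ r A μ 𝒰)
            (flatBundle T δ r A μ ρ),
          ∀ z, F.lift z = psi T δ r A μ (S.rank r) z • 1) ∧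
        -- `Ψ` carries the local holomorphic sections of `φ^*E` to those of `ℰ`
        ∀ (Ω : Set (Fin n → ℂ)) (s : (Fin n → ℂ) → (Fin (S.rank r) → ℂ)), IsOpen Ω →
          ContDiffOn ℝ ∞ s Ω →
          ((∀ z ∈ Ω, ∀ v, (pulledBundle T (im_det_ne_zero hT) δ hδ r A μ 𝒰).dbar s z v = 0) ↔
            DifferentiableOn ℂ (fun z => psi T δ r A μ (S.rank r) z • s z) Ω) := by
  have : NeZero (S.rank r) := ⟨S.rank_ne_zero hr⟩
  exact theorem5p1_general T (im_det_ne_zero hT) δ hδ r hr A (S.rank r) hA μ
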